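/- Let $M,N,k\ge 1$, let $\mathbf s\neq 0$ be a complex pilot vector with Euclidean norm $|\mathbf s|$, and let $\sigma_\beta,\sigma_z>0$. For $\mathbf x=(x_1,x_2)^{\mathsf T}\in\mathbb R^2$ put $\mathbf a(\mathbf x)=\mathbf a_1(x_1)\otimes \mathbf a_2(x_2)\in\mathbb C^{MN}$, where $\mathbf a_1(x_1)=\big(e^{2\pi i m x_1/M}\big)_{m=0}^{M-1}$ and $\mathbf a_2(x_2)=\big(e^{2\pi i n x_2/N}\big)_{n=0}^{N-1}$. Let $\mathbf W_1,\dots,\mathbf W_k\in\mathbb C^{MN\times 3}$ be given (deterministic) matrices. For a static direction $\mathbf x$ the observations are $$\mathbf y_l=|\mathbf s|\,\beta_l\,\mathbf W_l^{\mathsf H}\mathbf a(\mathbf x)+\mathbf z_l,\qquad l=1,\dots,k,$$ where the equivalent channel gains $\beta_l\sim\mathcal{CN}(0,\sigma_\beta^2)$ (Rayleigh fading) and the three entries of every noise vector $\mathbf z_l$, each distributed as $\mathcal{CN}(0,\sigma_z^2)$, are all mutually independent; $\sigma_\beta^2$ is a known constant that does not depend on $\mathbf x$. Let $$\mathbf g_l=\mathbf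 W_l^{\mathsf H}\mathbf a(\mathbf x),\quad \tilde g_{l,p}=\frac{\partial |\mathbf g_l|^2}{\partial x_p},\quad \mathbf G_{l,p}=\frac{\partial\, \mathbf g_l\mathbf g_l^{\mathsf H}}{\partial x_p}\ (p=1,2),\quad \boldsymbol\Sigma_l=|\mathbf s|^2\sigma_\beta^2\,\mathbf g_l\mathbf g_l^{\mathsf H}+\sigma_z^2\mathbf J_3,$$ where $\mathbf J_3$ is the $3\times3$ identity matrix, let $p_{DI}(\mathbf y\mid\mathbf x,\mathbf W_l)=\pi^{-3}(\det\boldsymbol\Sigma_l)^{-1}e^{-\mathbf y^{\mathsf H}\boldsymbol\Sigma_l^{-1}\mathbf y}$, and let $$\mathbf I_{DI}(\mathbf x,\mathbf W_l)=\mathbb E\Big[\frac{\partial\log p_{DI}(\mathbf y\mid\mathbf x,\mathbf W_l)}{\partial\mathbf x}\cdot\frac{\partial\log p_{DI}(\mathbf y\mid\mathbf x,\mathbf W_l)}{\partial\mathbf x^{\mathsf T}}\Big],\qquad \mathbf y\sim p_{DI}(\cdot\mid\mathbf x,\mathbf W_l),$$ be the $2\times 2$ Fisher information matrix. Fix $\mathbf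 x\in\mathbb R^2$. (1) Let $\hat{\mathbf x}_k=F(\mathbf y_1,\dots,\mathbf y_k)$, with $F$ measurable and $\mathbb R^2$-valued, be an estimate that is unbiased at all directions in a neighbourhood of $\mathbf x$, i.e. its expectation exists and equals the true direction whenever the true direction lies in that neighbourhood. If $\sum_{l=1}^k\mathbf I_{DI}(\mathbf x,\mathbf W_l)$ is invertible, then $$\mathbb E\big[\|\hat{\mathbf x}_k-\mathbf x\|_2^2\big]\ \ge\ \operatorname{Tr}\Big\{\Big(\sum_{l=1}^k\mathbf I_{DI}(\mathbf x,\mathbf W_l)\Big)^{-1}\Big\},$$ where the expectation, taken under the true direction $\mathbf x$, may be $+\infty$. (2) For all $l=1,\dots,k$ and $p,j\in\{1,2\}$ the expectation that defines $[\mathbf I_{DI}(\mathbf x,\mathbf W_l)]_{p,j}$ is finite (the integrand is integrable) and $$[\mathbf I_{DI}(\mathbf x,\mathbf W_l)]_{p,j}=\frac{\sigma_z^6|\mathbf s|^6\sigma_\beta^6}{(\det\boldsymbol\Sigma_l)^2}\Big\{-2|\mathbf g_l|^2\tilde g_{l,p}\tilde g_{l,j}+\frac{\sigma_z^2}{|\mathbf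 s|^2\sigma_\beta^2}\operatorname{Tr}\{\mathbf G_{l,p}\mathbf G_{l,j}\}+\mathbf g_l^{\mathsf H}\big(\mathbf G_{l,p}\mathbf G_{l,j}+\mathbf G_{l,j}\mathbf G_{l,p}\big)\mathbf g_l\Big\}.$$ -/

import Mathlib

open MeasureTheory ProbabilityTheory Filter Topology
open scoped Matrix NNReal ENNReal

namespace BeamTracking

noncomputable section

/-- The circularly symmetric complex Gaussian law `CN(0, σ²)`: real and imaginary parts are
independent real Gaussians of mean `0` and variance `σ² / 2`. -/
def complexGaussian (σ : ℝ) : Measure ℂ :=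
  ((gaussianReal 0 (Real.toNNReal (σ ^ 2 / 2))).prod
    (gaussianReal 0 (Real.toNNReal (σ ^ 2 / 2)))).map fun u : ℝ × ℝ => (⟨u.1, u.2⟩ : ℂ)

/-- One-dimensional steering vector `[1, e^{j2πt/n}, …, e^{j2π(n-1)t/n}]`. -/
def steering₁ (n : ℕ) (t : ℝ) : Fin n → ℂ := fun m =>
  Complex.exp (Complex.I * (2 * Real.pi * ((m : ℕ) : ℝ) / (n : ℝ) * t : ℝ))

/-- Two-dimensional steering vector `a(x) = a₁(x₁) ⊗ a₂(x₂)`; the entries of the Kronecker product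
are indexed by pairs. -/
def steering (M N : ℕ) (x : EuclideanSpace ℝ (Fin 2)) : Fin M × Fin N → ℂ := fun q =>
  steering₁ M (x 0) q.1 * steering₁ N (x 1) q.2

variable {M N : ℕ}

/-- `g = Wᴴ a(x)`. -/
def gVec (W : Matrix (Fin M × Fin N) (Fin 3) ℂ) (x : EuclideanSpace ℝ (Fin 2)) : Fin 3 → ℂ :=
  Wᴴ *ᵥ steering M N x

/-- `|g|²`, the squared Euclidean modulus of `g = Wᴴ a(x)`. -/
def gSq (W : Matrix (Fin M × Fin N) (Fin 3) ℂ) (x : EuclideanSpace ℝ (Fin 2)) : ℝ :=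
  ∑ i, ‖gVec W x i‖ ^ 2

/-- `g gᴴ`. -/
def gOuter (W : Matrix (Fin M × Fin N) (Fin 3) ℂ) (x : EuclideanSpace ℝ (Fin 2)) :
    Matrix (Fin 3) (Fin 3) ℂ :=
  Matrix.vecMulVec (gVec W x) (star (gVec W x))

/-- The partial derivative `∂f/∂x_p` at `x`. -/
def partialD {E : Type*} [NormedAddCommGroup E] [NormedSpace ℝ E]
    (f : EuclideanSpace ℝ (Fin 2) → E) (p : Fin 2) (x : EuclideanSpace ℝ (Fin 2)) : E :=
  lineDeriv ℝ f x (EuclideanSpace.single p (1 : ℝ))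

/-- `g̃_p = ∂|g|²/∂x_p`. -/
def gTilde (W : Matrix (Fin M × Fin N) (Fin 3) ℂ) (x : EuclideanSpace ℝ (Fin 2)) (p : Fin 2) : ℝ :=
  partialD (gSq W) p x

/-- `G_p = ∂(g gᴴ)/∂x_p`, entry by entry. -/
def gMat (W : Matrix (Fin M × Fin N) (Fin 3) ℂ) (x : EuclideanSpace ℝ (Fin 2)) (p : Fin 2) :
    Matrix (Fin 3) (Fin 3) ℂ :=
  Matrix.of fun i i' => partialD (fun x' => gOuter W x' i i') p x

/-- The observation vector `y = |s| β Wᴴ a(x) + z` for the equivalent channel gain `β`, the noise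
vector `z` and the modulus `S = |s|` of the pilot sequence. -/
def observation (S : ℝ) (W : Matrix (Fin M × Fin N) (Fin 3) ℂ) (x : EuclideanSpace ℝ (Fin 2))
    (β : ℂ) (z : Fin 3 → ℂ) : Fin 3 → ℂ :=
  ((S : ℂ) * β) • gVec W x + z

/-- The covariance matrix `Σ_y = |s|² σ_β² g gᴴ + σ_z² J₃` of the observation vector. -/
def covDI (S σβ σz : ℝ) (W : Matrix (Fin M × Fin N) (Fin 3) ℂ) (x : EuclideanSpace ℝ (Fin 2)) :
    Matrix (Fin 3) (Fin 3) ℂ :=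
  ((S ^ 2 * σβ ^ 2 : ℝ) : ℂ) • gOuter W x + ((σz ^ 2 : ℝ) : ℂ) • (1 : Matrix (Fin 3) (Fin 3) ℂ)

/-- The density `p_DI(y | x, W) = exp(-yᴴ Σ_y⁻¹ y) / (π³ |Σ_y|)`. The determinant and the quadratic
form are real because `Σ_y` is Hermitian. -/
def pDI (S σβ σz : ℝ) (W : Matrix (Fin M × Fin N) (Fin 3) ℂ) (x : EuclideanSpace ℝ (Fin 2))
    (y : Fin 3 → ℂ) : ℝ :=
  1 / (Real.pi ^ 3 * (covDI S σβ σz W x).det.re) *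
    Real.exp (-(star y ⬝ᵥ ((covDI S σβ σz W x)⁻¹ *ᵥ y)).re)

/-- The score `∂ log p_DI(y | x, W) / ∂x_p`. -/
def scoreDI (S σβ σz : ℝ) (W : Matrix (Fin M × Fin N) (Fin 3) ℂ) (x : EuclideanSpace ℝ (Fin 2))
    (p : Fin 2) (y : Fin 3 → ℂ) : ℝ :=
  partialD (fun x' => Real.log (pDI S σβ σz W x' y)) p x

/-- The Fisher information matrix
`I_DI(x, W) = E[(∂ log p_DI / ∂x) (∂ log p_DI / ∂xᵀ)]`, where `y` has density `p_DI(· | x, W)`. -/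
def fisherDI (S σβ σz : ℝ) (W : Matrix (Fin M × Fin N) (Fin 3) ℂ) (x : EuclideanSpace ℝ (Fin 2)) :
    Matrix (Fin 2) (Fin 2) ℝ :=
  Matrix.of fun p j =>
    ∫ y, scoreDI S σβ σz W x p y * scoreDI S σβ σz W x j y * pDI S σβ σz W x y

end

end BeamTracking

/-!
Stacked into one vector, the observations of all cycles are circularly symmetric complex Gaussian
with a block-diagonal covariance matrix `C`. If `C` moves in a Hermitian direction `H`, the score is
the centered quadratic form `yᴴ C⁻¹ H C⁻¹ y - tr (C⁻¹ H)`, and Wick's formula for fourth moments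
gives the Fisher information `tr (C⁻¹ H C⁻¹ K)`, which is additive over the blocks.

For the bound, `E_x[F] = x` is differentiated under the integral sign; near `x` the densities are
dominated by the one at `x` times `exp (η ‖y‖²)` with arbitrarily small `η > 0`. Hence the error
`F - x` is biorthogonal to the scores in `L²`, and Bessel's inequality bounds its norm by the trace
of the inverse Gram matrix of the scores.

For the closed form, each `Σ` is a scalar plus a rank-one matrix, so that Sherman–Morrison expresses
`tr (Σ⁻¹ H Σ⁻¹ K)` through quadratic forms in `g`.
-/

namespace BeamTracking

open scoped ComplexConjugate ComplexOrder MatrixOrder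

section ScalarGaussian

theorem complexGaussian_eq_map (σ : ℝ) :
    complexGaussian σ =
      ((gaussianReal 0 (Real.toNNReal (σ ^ 2 / 2))).prod
        (gaussianReal 0 (Real.toNNReal (σ ^ 2 / 2)))).map
          (Complex.equivRealProdCLM.symm : ℝ × ℝ →L[ℝ] ℂ) :=
  congrArg (Measure.map · _) <| funext fun u => by
    simp [Complex.mk_eq_add_mul_I, Complex.equivRealProdCLM_symm_apply]

instance isGaussian_complexGaussian (σ : ℝ) : IsGaussian (complexGaussian σ) := by
  rw [complexGaussian_eq_map]
  infer_instance

theorem charFunDual_gaussianReal_zero (v : ℝ≥0) (f : StrongDual ℝ ℝ) :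
    charFunDual (gaussianReal 0 v) f = Complex.exp (-(v * f 1 ^ 2 / 2 : ℝ)) := by
  have hf (u : ℝ) : f u = f 1 * u := by
    rw [mul_comm, ← smul_eq_mul u, ← map_smul, smul_eq_mul, mul_one]
  rw [charFunDual_apply, integral_congr_ae (ae_of_all _ fun u => by rw [hf u, Complex.ofReal_mul]),
    ← charFun_apply_real, charFun_gaussianReal]
  simp

theorem charFunDual_complexGaussian (σ : ℝ) (f : StrongDual ℝ ℂ) :
    charFunDual (complexGaussian σ) f =
      Complex.exp (-(σ ^ 2 * (f 1 ^ 2 + f Complex.I ^ 2) / 4 : ℝ)) := by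
  rw [complexGaussian_eq_map, charFunDual_map, charFunDual_prod, charFunDual_gaussianReal_zero,
    charFunDual_gaussianReal_zero, ← Complex.exp_add]
  simp only [ContinuousLinearMap.comp_apply, ContinuousLinearMap.inl_apply,
    ContinuousLinearMap.inr_apply, ContinuousLinearEquiv.coe_coe,
    Complex.equivRealProdCLM_symm_apply, Real.coe_toNNReal _ (by positivity : 0 ≤ σ ^ 2 / 2)]
  push_cast
  simp only [zero_mul, add_zero, zero_add, one_mul]
  ring_nf

theorem complexGaussian_one_eq_withDensity :
    complexGaussian 1 =
      volume.withDensity fun w => ENNReal.ofReal (Real.exp (-‖w‖ ^ 2) / Real.pi) := by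
  have hv : Real.toNNReal (1 ^ 2 / 2) ≠ 0 := by simp
  let e := Complex.measurableEquivRealProd
  ext s hs
  rw [complexGaussian, gaussianReal_of_var_ne_zero 0 hv,
    prod_withDensity (by fun_prop) (by fun_prop), withDensity_apply _ hs]
  change (Measure.map e.symm _) s = _
  rw [e.symm.map_apply, withDensity_apply _ (e.symm.measurable hs),
    ← (Complex.volume_preserving_equiv_real_prod.symm _).setLIntegral_comp_preimage hs
      (by fun_prop)]
  refine lintegral_congr fun u => ?_
  rw [gaussianPDF, gaussianPDF, ← ENNReal.ofReal_mul (gaussianPDFReal_nonneg _ _ _)]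
  congr 1
  rw [gaussianPDFReal, gaussianPDFReal, Complex.measurableEquivRealProd_symm_apply,
    ← Complex.normSq_eq_norm_sq, Complex.normSq_mk, mul_mul_mul_comm, ← Real.exp_add, ← mul_inv,
    Real.mul_self_sqrt (by positivity), mul_comm, div_eq_mul_inv]
  congr 2
  · simp
    ring
  · simp
    ring

theorem integral_norm_pow_complexGaussian_one (n : ℕ) :
    ∫ w, ‖w‖ ^ (2 * n) ∂complexGaussian 1 = n.factorial := by
  have h := Complex.integral_rpow_mul_exp_neg_rpow (p := 2) (q := (2 * n : ℕ)) one_le_two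
    (lt_of_lt_of_le (by norm_num) (Nat.cast_nonneg _))
  have hq : (((2 * n : ℕ) : ℝ) + 2) / 2 = (n : ℝ) + 1 := by push_cast; ring
  rw [hq, Real.Gamma_nat_eq_factorial] at h
  rw [complexGaussian_one_eq_withDensity,
    integral_withDensity_eq_integral_toReal_smul (by fun_prop)
      (ae_of_all _ fun _ => ENNReal.ofReal_lt_top)]
  calc _ = ∫ w : ℂ, (‖w‖ ^ ((2 * n : ℕ) : ℝ) * Real.exp (-‖w‖ ^ (2 : ℝ))) * Real.pi⁻¹ := by
        refine integral_congr_ae (ae_of_all _ fun w => ?_)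
        dsimp only
        rw [ENNReal.toReal_ofReal (by positivity), Real.rpow_natCast, Real.rpow_two, smul_eq_mul]
        ring
    _ = n.factorial := by
        rw [integral_mul_const, h]
        field_simp

theorem integrable_pow_mul_conj_pow_complexGaussian (σ : ℝ) (m n : ℕ) :
    Integrable (fun w => w ^ m * conj w ^ n) (complexGaussian σ) := by
  have h : Integrable (fun w : ℂ => ‖w‖ ^ (m + n)) (complexGaussian σ) :=
    (IsGaussian.memLp_id (complexGaussian σ) (m + n : ℕ) (by simp)).integrable_norm_pow'
  refine h.mono' (by fun_prop) (ae_of_all _ fun w => ?_)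
  simp [pow_add]

theorem complexGaussian_map_mul_left (σ : ℝ) {c : ℂ} (hc : ‖c‖ = 1) :
    (complexGaussian σ).map (c * ·) = complexGaussian σ := by
  refine Measure.ext_of_charFunDual (funext fun f => ?_)
  have hf (w : ℂ) : f w = w.re * f 1 + w.im * f Complex.I := by
    conv_lhs => rw [← Complex.re_add_im w, ← mul_one (w.re : ℂ)]
    rw [map_add, ← Complex.real_smul, ← Complex.real_smul, map_smul, map_smul, smul_eq_mul,
      smul_eq_mul]
  have hc' : c.re ^ 2 + c.im ^ 2 = 1 := by
    rw [← one_pow 2, ← hc, ← Complex.normSq_eq_norm_sq, Complex.normSq_apply, sq, sq]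
  refine (charFunDual_map (ContinuousLinearMap.mul ℝ ℂ c) f).trans ?_
  rw [charFunDual_complexGaussian, charFunDual_complexGaussian]
  congr 4
  simp only [ContinuousLinearMap.comp_apply, ContinuousLinearMap.mul_apply', mul_one]
  rw [hf c, hf (c * Complex.I), Complex.mul_I_re, Complex.mul_I_im]
  linear_combination σ ^ 2 * (f 1 ^ 2 + f Complex.I ^ 2) * hc'

theorem integral_pow_mul_conj_pow_complexGaussian_one (m n : ℕ) :
    ∫ w, w ^ m * conj w ^ n ∂complexGaussian 1 = if m = n then (m.factorial : ℂ) else 0 := by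
  split_ifs with h
  · subst h
    rw [← Complex.ofReal_natCast, ← integral_norm_pow_complexGaussian_one,
      ← integral_complex_ofReal]
    simp only [← mul_pow, Complex.mul_conj, Complex.normSq_eq_norm_sq, pow_mul, Complex.ofReal_pow]
  · have hmn : (m : ℂ) - n ≠ 0 := sub_ne_zero.mpr (by exact_mod_cast h)
    -- multiplication by `c = exp (iπ / (m - n))` preserves the law and flips the integrand's sign
    let c : ℂ := Complex.exp ((Real.pi / (m - n) : ℝ) * Complex.I)
    have hnorm : ‖c‖ = 1 := Complex.norm_exp_ofReal_mul_I _
    have hflip : c ^ m * conj c ^ n = -1 := by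
      rw [← Complex.exp_conj, ← Complex.exp_nat_mul, ← Complex.exp_nat_mul, ← Complex.exp_add,
        ← Complex.exp_pi_mul_I, map_mul, Complex.conj_I, Complex.conj_ofReal]
      congr 1
      push_cast
      field_simp
      ring
    rw [← self_eq_neg]
    calc ∫ w, w ^ m * conj w ^ n ∂complexGaussian 1
        = ∫ w, (c * w) ^ m * conj (c * w) ^ n ∂complexGaussian 1 := by
          conv_lhs => rw [← complexGaussian_map_mul_left 1 hnorm]
          exact integral_map (by fun_prop) (by fun_prop)
      _ = ∫ w, -(w ^ m * conj w ^ n) ∂complexGaussian 1 := by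
          refine integral_congr_ae (ae_of_all _ fun w => ?_)
          linear_combination (norm := (simp only [map_mul]; ring)) w ^ m * conj w ^ n * hflip
      _ = -∫ w, w ^ m * conj w ^ n ∂complexGaussian 1 := integral_neg _

end ScalarGaussian

section CircularGaussian

variable {m n : Type*} [Fintype m] [Fintype n] [DecidableEq n]

omit [DecidableEq n] in
theorem exists_eq_re_star_dotProduct (f : StrongDual ℝ (n → ℂ)) :
    ∃ t : n → ℂ, ∀ y, f y = (star t ⬝ᵥ y).re := by
  classical
  let g : Module.Dual ℂ (n → ℂ) := Module.Dual.extendRCLike f.toLinearMap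
  refine ⟨star ((dotProductEquiv ℂ n).symm g), fun y => ?_⟩
  rw [star_star, ← dotProductEquiv_apply_apply, LinearEquiv.apply_symm_apply]
  exact (Module.Dual.re_extendRCLike_apply (𝕜 := ℂ) f.toLinearMap y).symm

theorem charFunDual_map_mulVec_pi_complexGaussian (τ : n → ℝ) (A : Matrix m n ℂ)
    {f : StrongDual ℝ (m → ℂ)} {t : m → ℂ} (ht : ∀ y, f y = (star t ⬝ᵥ y).re) :
    charFunDual ((Measure.pi fun i => complexGaussian (τ i)).map (A *ᵥ ·)) f =
      Complex.exp (-(star t ⬝ᵥ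
        ((A * Matrix.diagonal (fun i => (τ i : ℂ) ^ 2) * Aᴴ) *ᵥ t)) / 4) := by
  let L : (n → ℂ) →L[ℝ] (m → ℂ) :=
    ((Matrix.mulVecLin A).restrictScalars ℝ).toContinuousLinearMap
  let u := Aᴴ *ᵥ t
  have hu : star t ᵥ* A = star u := by rw [Matrix.star_mulVec, Matrix.conjTranspose_conjTranspose]
  have hcomp (i : n) (w : ℂ) : f (L (Pi.single i w)) = (conj (u i) * w).re := by
    change f (A *ᵥ Pi.single i w) = _
    rw [ht, Matrix.dotProduct_mulVec, dotProduct_single, hu]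
    rfl
  have hquad : star t ⬝ᵥ ((A * Matrix.diagonal (fun i => (τ i : ℂ) ^ 2) * Aᴴ) *ᵥ t) =
      ∑ i, (τ i : ℂ) ^ 2 * (u i * conj (u i)) := by
    rw [← Matrix.mulVec_mulVec, ← Matrix.mulVec_mulVec, Matrix.dotProduct_mulVec,
      hu, dotProduct]
    simp only [Matrix.mulVec_diagonal, Pi.star_apply, Complex.star_def]
    exact Finset.sum_congr rfl fun i _ => by ring
  refine (charFunDual_map L f).trans ?_
  rw [charFunDual_pi]
  simp_rw [charFunDual_complexGaussian, ← Complex.exp_sum]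
  rw [hquad, neg_div, Finset.sum_div, ← Finset.sum_neg_distrib]
  refine congrArg Complex.exp (Finset.sum_congr rfl fun i _ => ?_)
  simp only [ContinuousLinearMap.comp_apply, ContinuousLinearMap.single_apply, hcomp,
    Complex.mul_conj, Complex.normSq_apply, mul_one, Complex.mul_I_re, Complex.conj_re,
    Complex.conj_im]
  push_cast
  ring

/-- The density of the circularly symmetric complex Gaussian law with covariance matrix `C`. The
determinant and the quadratic form are real when `C` is Hermitian. -/
noncomputable def gaussianDensity (C : Matrix n n ℂ) (y : n → ℂ) : ℝ :=
  1 / (Real.pi ^ Fintype.card n * C.det.re) * Real.exp (-(star y ⬝ᵥ (C⁻¹ *ᵥ y)).re)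

/-- The circularly symmetric complex Gaussian law `CN(0, C)`, for positive definite `C`. It is
defined by its density, which is what parameter derivatives act on. -/
noncomputable def circularGaussian (C : Matrix n n ℂ) : Measure (n → ℂ) :=
  volume.withDensity fun y => ENNReal.ofReal (gaussianDensity C y)

@[fun_prop]
theorem continuous_gaussianDensity (C : Matrix n n ℂ) : Continuous (gaussianDensity C) := by
  unfold gaussianDensity
  fun_prop

theorem det_re_pos {C : Matrix n n ℂ} (hC : C.PosDef) : 0 < C.det.re :=
  (Complex.pos_iff.mp hC.det_pos).1

theorem gaussianDensity_pos {C : Matrix n n ℂ} (hC : C.PosDef) (y : n → ℂ) :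
    0 < gaussianDensity C y := by
  have := det_re_pos hC
  unfold gaussianDensity
  positivity

theorem pi_withDensity_ofReal {ι : Type*} [Fintype ι] {E : ι → Type*}
    [∀ i, MeasurableSpace (E i)] (μ : ∀ i, Measure (E i)) [∀ i, SigmaFinite (μ i)]
    {f : ∀ i, E i → ℝ} (hf : ∀ i, Integrable (f i) (μ i)) (hf_nonneg : ∀ i v, 0 ≤ f i v) :
    Measure.pi (fun i => (μ i).withDensity fun v => ENNReal.ofReal (f i v)) =
      (Measure.pi μ).withDensity fun v => ENNReal.ofReal (∏ i, f i (v i)) := by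
  have : ∀ i, IsFiniteMeasure ((μ i).withDensity fun v => ENNReal.ofReal (f i v)) := fun i =>
    isFiniteMeasure_withDensity_ofReal (hf i).2
  refine Measure.pi_eq fun s hs => ?_
  have hprod : Integrable (fun v : ∀ i, E i => ∏ i, f i (v i))
      (Measure.pi fun i => (μ i).restrict (s i)) :=
    Integrable.fintype_prod_dep fun i => (hf i).restrict
  rw [withDensity_apply _ (MeasurableSet.univ_pi hs), Measure.restrict_pi_pi,
    ← ofReal_integral_eq_lintegral_ofReal hprod
      (ae_of_all _ fun v => Finset.prod_nonneg fun i _ => hf_nonneg i _),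
    integral_fintype_prod_eq_prod,
    ENNReal.ofReal_prod_of_nonneg fun i _ => integral_nonneg fun v => hf_nonneg i v]
  refine Finset.prod_congr rfl fun i _ => ?_
  rw [withDensity_apply _ (hs i),
    ofReal_integral_eq_lintegral_ofReal (hf i).restrict (ae_of_all _ fun v => hf_nonneg i v)]

theorem pi_complexGaussian_one :
    (Measure.pi fun _ : n => complexGaussian 1) = circularGaussian 1 := by
  have hint : Integrable fun w : ℂ => Real.exp (-‖w‖ ^ 2) / Real.pi := by
    refine (lintegral_ofReal_ne_top_iff_integrable (by fun_prop)
      (ae_of_all _ fun w => by positivity)).mp ?_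
    rw [← setLIntegral_univ, ← withDensity_apply _ MeasurableSet.univ,
      ← complexGaussian_one_eq_withDensity]
    exact measure_ne_top _ _
  simp_rw [complexGaussian_one_eq_withDensity]
  rw [pi_withDensity_ofReal _ (fun _ => hint) fun _ w => by positivity]
  refine congrArg _ (funext fun y => congrArg _ ?_)
  have hnorm : (star y ⬝ᵥ y).re = ∑ i, ‖y i‖ ^ 2 := by
    simp only [dotProduct, Pi.star_apply, Complex.star_def, ← Complex.normSq_eq_conj_mul_self,
      Complex.normSq_eq_norm_sq, Complex.re_sum, Complex.ofReal_re]
  rw [gaussianDensity, inv_one, Matrix.one_mulVec, hnorm, Finset.prod_div_distrib,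
    ← Real.exp_sum, Finset.sum_neg_distrib, Matrix.det_one, Complex.one_re, mul_one,
    one_div_mul_eq_div, Finset.prod_const, Finset.card_univ]

theorem gaussianDensity_one_eq_mul {R : Matrix n n ℂ} (hR : IsUnit R.det) (y : n → ℂ) :
    gaussianDensity 1 y = ‖R.det‖ ^ 2 * gaussianDensity (R * Rᴴ) (R *ᵥ y) := by
  have hRH : IsUnit Rᴴ.det := by
    rw [Matrix.det_conjTranspose]
    exact hR.star
  have hquad : star (R *ᵥ y) ⬝ᵥ ((R * Rᴴ)⁻¹ *ᵥ (R *ᵥ y)) = star y ⬝ᵥ y := by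
    rw [Matrix.mul_inv_rev, ← Matrix.mulVec_mulVec, Matrix.mulVec_mulVec y,
      Matrix.nonsing_inv_mul _ hR, Matrix.one_mulVec, Matrix.star_mulVec,
      ← Matrix.dotProduct_mulVec, Matrix.mulVec_mulVec, Matrix.mul_nonsing_inv _ hRH,
      Matrix.one_mulVec]
  have hdet : (R * Rᴴ).det.re = ‖R.det‖ ^ 2 := by
    rw [Matrix.det_mul, Matrix.det_conjTranspose, Complex.star_def, Complex.mul_conj,
      Complex.ofReal_re, Complex.normSq_eq_norm_sq]
  have hnorm : ‖R.det‖ ≠ 0 := norm_ne_zero_iff.mpr hR.ne_zero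
  rw [gaussianDensity, gaussianDensity, hquad, hdet, inv_one, Matrix.one_mulVec, Matrix.det_one,
    Complex.one_re]
  field_simp

theorem circularGaussian_one_map_mulVec {R : Matrix n n ℂ} (hR : IsUnit R.det) :
    (circularGaussian 1).map (R *ᵥ ·) = circularGaussian (R * Rᴴ) := by
  have hdet_pos : 0 < ‖R.det‖ ^ 2 := pow_pos (norm_pos_iff.mpr hR.ne_zero) 2
  let L := (Matrix.mulVecLin R).restrictScalars ℝ
  have hdetL : LinearMap.det L = ‖R.det‖ ^ 2 := by
    rw [LinearMap.det_restrictScalars, Algebra.norm_complex_apply, Complex.normSq_eq_norm_sq,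
      ← Matrix.toLin'_apply', LinearMap.det_toLin']
  have hvol : (volume : Measure (n → ℂ)).map (R *ᵥ ·) =
      ENNReal.ofReal (‖R.det‖ ^ 2)⁻¹ • volume := by
    rw [← abs_of_pos (inv_pos.mpr hdet_pos), ← hdetL]
    exact Measure.map_linearMap_addHaar_eq_smul_addHaar volume (f := L)
      (hdetL.trans_ne hdet_pos.ne')
  ext s hs
  have hR_meas : Measurable (R *ᵥ · : (n → ℂ) → n → ℂ) := by fun_prop
  rw [Measure.map_apply hR_meas hs, circularGaussian, circularGaussian,
    withDensity_apply _ (hR_meas hs), withDensity_apply _ hs]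
  simp_rw [gaussianDensity_one_eq_mul hR, ENNReal.ofReal_mul hdet_pos.le]
  rw [lintegral_const_mul _ (by fun_prop),
    ← setLIntegral_map hs (f := fun v => ENNReal.ofReal (gaussianDensity (R * Rᴴ) v)) (by fun_prop)
      hR_meas, hvol, Measure.restrict_smul, lintegral_smul_measure, smul_eq_mul, ← mul_assoc,
    ← ENNReal.ofReal_mul hdet_pos.le, mul_inv_cancel₀ hdet_pos.ne', ENNReal.ofReal_one, one_mul]

omit [Fintype m] in
theorem exists_isUnit_det_mul_conjTranspose_eq {C : Matrix n n ℂ} (hC : C.PosDef) :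
    ∃ R : Matrix n n ℂ, IsUnit R.det ∧ R * Rᴴ = C := by
  obtain ⟨B, hB⟩ := CStarAlgebra.nonneg_iff_eq_star_mul_self.mp hC.posSemidef.nonneg
  have hBC : Bᴴ * Bᴴᴴ = C := by
    rw [Matrix.conjTranspose_conjTranspose, hB, Matrix.star_eq_conjTranspose]
  refine ⟨Bᴴ, ?_, hBC⟩
  have hdet : IsUnit (Bᴴ * Bᴴᴴ).det := hBC ▸ (Matrix.isUnit_iff_isUnit_det C).mp hC.isUnit
  rw [Matrix.det_mul] at hdet
  exact isUnit_of_mul_isUnit_left hdet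

theorem pi_complexGaussian_map_mulVec [DecidableEq m] (τ : n → ℝ) (A : Matrix m n ℂ)
    {C : Matrix m m ℂ} (hC : C.PosDef)
    (hA : A * Matrix.diagonal (fun i => (τ i : ℂ) ^ 2) * Aᴴ = C) :
    (Measure.pi fun i => complexGaussian (τ i)).map (A *ᵥ ·) = circularGaussian C := by
  obtain ⟨R, hR, hRC⟩ := exists_isUnit_det_mul_conjTranspose_eq hC
  have hA_meas : Measurable (A *ᵥ · : (n → ℂ) → m → ℂ) := by fun_prop
  have hR_meas : Measurable (R *ᵥ · : (m → ℂ) → m → ℂ) := by fun_prop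
  have := Measure.isProbabilityMeasure_map (μ := Measure.pi fun i => complexGaussian (τ i))
    hA_meas.aemeasurable
  have := Measure.isProbabilityMeasure_map (μ := Measure.pi fun _ : m => complexGaussian 1)
    hR_meas.aemeasurable
  rw [← hRC, ← circularGaussian_one_map_mulVec hR, ← pi_complexGaussian_one]
  refine Measure.ext_of_charFunDual (funext fun f => ?_)
  obtain ⟨t, ht⟩ := exists_eq_re_star_dotProduct f
  rw [charFunDual_map_mulVec_pi_complexGaussian τ A ht, hA,
    charFunDual_map_mulVec_pi_complexGaussian (fun _ => 1) R ht]
  simp [hRC]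

theorem isGaussian_circularGaussian {C : Matrix n n ℂ} (hC : C.PosDef) :
    IsGaussian (circularGaussian C) := by
  obtain ⟨R, hR, hRC⟩ := exists_isUnit_det_mul_conjTranspose_eq hC
  have hcoord (i : n) : HasGaussianLaw (fun w : n → ℂ => w i)
      (Measure.pi fun _ => complexGaussian 1) := by
    constructor
    rw [(measurePreserving_eval (fun _ : n => complexGaussian 1) i).map_eq]
    infer_instance
  have hlaw := iIndepFun.hasGaussianLaw hcoord
    (iIndepFun_pi (X := fun _ : n => (id : ℂ → ℂ)) fun _ => aemeasurable_id)
  have : IsGaussian (Measure.pi fun _ : n => complexGaussian 1) := by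
    simpa only [Measure.map_id'] using hlaw.isGaussian_map
  have hmap := isGaussian_map (μ := Measure.pi fun _ : n => complexGaussian 1)
    ((Matrix.mulVecLin R).restrictScalars ℝ).toContinuousLinearMap
  rw [← hRC, ← circularGaussian_one_map_mulVec hR, ← pi_complexGaussian_one]
  exact hmap

end CircularGaussian

section Moments

variable {n : Type*} [Fintype n]

theorem integral_prod_pow_mul_conj_pow (p q : n → ℕ) :
    ∫ w, (∏ i, w i ^ p i) * ∏ i, conj (w i) ^ q i ∂(Measure.pi fun _ : n => complexGaussian 1) =
      if p = q then ((∏ i, (p i).factorial : ℕ) : ℂ) else 0 := by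
  simp_rw [← Finset.prod_mul_distrib]
  rw [integral_fintype_prod_eq_prod (𝕜 := ℂ) fun i w => w ^ p i * conj w ^ q i]
  simp_rw [integral_pow_mul_conj_pow_complexGaussian_one]
  split_ifs with h
  · subst h
    simp
  · obtain ⟨i, hi⟩ := Function.ne_iff.mp h
    exact Finset.prod_eq_zero (Finset.mem_univ i) (if_neg hi)

theorem integrable_prod_pow_mul_conj_pow (p q : n → ℕ) :
    Integrable (fun w : n → ℂ => (∏ i, w i ^ p i) * ∏ i, conj (w i) ^ q i)
      (Measure.pi fun _ => complexGaussian 1) := by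
  simp_rw [← Finset.prod_mul_distrib]
  exact Integrable.fintype_prod_dep (𝕜 := ℂ)
    fun i => integrable_pow_mul_conj_pow_complexGaussian 1 (p i) (q i)

variable [DecidableEq n]

theorem prod_pow_single {R : Type*} [CommMonoid R] (w : n → R) (a : n) :
    ∏ i, w i ^ (Pi.single a 1 : n → ℕ) i = w a := by
  simp [Pi.single_apply, pow_ite, Finset.prod_ite_eq']

theorem prod_factorial_single_add_single (b d : n) :
    ∏ i, ((Pi.single b 1 + Pi.single d 1 : n → ℕ) i).factorial = if b = d then 2 else 1 := by
  split_ifs with h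
  · subst h
    rw [Finset.prod_eq_single b (fun i _ hi => by simp [hi]) (by simp)]
    simp
  · refine Finset.prod_eq_one fun i _ => Nat.factorial_eq_one.mpr ?_
    rw [Pi.add_apply, Pi.single_apply, Pi.single_apply]
    split_ifs with hb hd
    · exact absurd (hb.symm.trans hd) h
    all_goals simp

theorem integral_conj_mul (a b : n) :
    ∫ w, conj (w a) * w b ∂circularGaussian (1 : Matrix n n ℂ) = if a = b then 1 else 0 := by
  have h := integral_prod_pow_mul_conj_pow (Pi.single b 1) (Pi.single a 1 : n → ℕ)
  simp only [prod_pow_single, pi_complexGaussian_one] at h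
  simp_rw [mul_comm (conj _)]
  rw [h]
  by_cases hab : a = b
  · subst hab
    simp [Pi.single_apply, apply_ite Nat.factorial]
  · rw [if_neg hab, if_neg fun h' => one_ne_zero (α := ℕ) ?_]
    simpa [hab] using (congrFun h' a).symm

theorem integrable_conj_mul (a b : n) :
    Integrable (fun w : n → ℂ => conj (w a) * w b) (circularGaussian 1) := by
  have h := integrable_prod_pow_mul_conj_pow (Pi.single b 1) (Pi.single a 1 : n → ℕ)
  simp only [prod_pow_single, pi_complexGaussian_one] at h
  simpa only [mul_comm] using h

theorem integrable_conj_mul_conj_mul (a b c d : n) :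
    Integrable (fun w : n → ℂ => conj (w a) * w b * (conj (w c) * w d))
      (circularGaussian 1) := by
  have h := integrable_prod_pow_mul_conj_pow
    (Pi.single b 1 + Pi.single d 1) (Pi.single a 1 + Pi.single c 1 : n → ℕ)
  simp only [Pi.add_apply, pow_add, Finset.prod_mul_distrib, prod_pow_single,
    pi_complexGaussian_one] at h
  refine h.congr (ae_of_all _ fun w => ?_)
  dsimp only
  ring

theorem integral_conj_mul_conj_mul (a b c d : n) :
    ∫ w, conj (w a) * w b * (conj (w c) * w d) ∂circularGaussian (1 : Matrix n n ℂ) =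
      (if a = b then 1 else 0) * (if c = d then 1 else 0) +
        (if a = d then 1 else 0) * (if c = b then 1 else 0) := by
  have h := integral_prod_pow_mul_conj_pow
    (Pi.single b 1 + Pi.single d 1) (Pi.single a 1 + Pi.single c 1 : n → ℕ)
  rw [prod_factorial_single_add_single] at h
  simp only [pow_add, Finset.prod_mul_distrib, prod_pow_single, pi_complexGaussian_one,
    Pi.add_apply,
    Pi.single_add_single_eq_single_add_single (one_ne_zero (α := ℕ)) one_ne_zero] at h
  have hcomm (w : n → ℂ) :
      conj (w a) * w b * (conj (w c) * w d) = w b * w d * (conj (w a) * conj (w c)) := by ring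
  simp_rw [hcomm]
  rw [h, Nat.cast_ite, Nat.cast_ofNat, Nat.cast_one]
  grind

omit [DecidableEq n] in
theorem star_dotProduct_mulVec_eq_sum (B : Matrix n n ℂ) (y : n → ℂ) :
    star y ⬝ᵥ (B *ᵥ y) = ∑ i : n × n, B i.1 i.2 * (conj (y i.1) * y i.2) := by
  simp only [dotProduct, Matrix.mulVec, Finset.mul_sum, Pi.star_apply, Complex.star_def,
    Fintype.sum_prod_type, mul_left_comm]

omit [DecidableEq n] in
theorem norm_star_dotProduct_mulVec_le (B : Matrix n n ℂ) (y : n → ℂ) :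
    ‖star y ⬝ᵥ (B *ᵥ y)‖ ≤ (∑ i : n × n, ‖B i.1 i.2‖) * ‖y‖ ^ 2 := by
  simp_rw [star_dotProduct_mulVec_eq_sum, Finset.sum_mul]
  refine norm_sum_le_of_le _ fun i _ => ?_
  rw [norm_mul, norm_mul, RCLike.norm_conj, sq]
  gcongr <;> exact norm_le_pi_norm y _

theorem integrable_star_dotProduct_mulVec_pow {C : Matrix n n ℂ} (hC : C.PosDef)
    (B : Matrix n n ℂ) (k : ℕ) :
    Integrable (fun y => (star y ⬝ᵥ (B *ᵥ y)) ^ k) (circularGaussian C) := by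
  have := isGaussian_circularGaussian hC
  have h : Integrable (fun y => ‖y‖ ^ (2 * k)) (circularGaussian C) :=
    (IsGaussian.memLp_id _ (2 * k : ℕ) (ENNReal.natCast_ne_top _)).integrable_norm_pow'
  refine (h.const_mul ((∑ i : n × n, ‖B i.1 i.2‖) ^ k)).mono' (by fun_prop)
    (ae_of_all _ fun y => ?_)
  rw [norm_pow, pow_mul, ← mul_pow]
  gcongr
  exact norm_star_dotProduct_mulVec_le B y

theorem integral_star_dotProduct_mulVec_one (B : Matrix n n ℂ) :
    ∫ w, star w ⬝ᵥ (B *ᵥ w) ∂circularGaussian 1 = B.trace := by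
  simp_rw [star_dotProduct_mulVec_eq_sum]
  rw [integral_finsetSum _ fun i _ => (integrable_conj_mul i.1 i.2).const_mul _]
  simp_rw [integral_const_mul, integral_conj_mul]
  simp [Matrix.trace, Fintype.sum_prod_type]

theorem integral_star_dotProduct_mulVec_mul_one (B D : Matrix n n ℂ) :
    ∫ w, (star w ⬝ᵥ (B *ᵥ w)) * (star w ⬝ᵥ (D *ᵥ w)) ∂circularGaussian 1 =
      B.trace * D.trace + (B * D).trace := by
  calc _ = ∫ w, ∑ i : (n × n) × n × n, B i.1.1 i.1.2 * D i.2.1 i.2.2 *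
          (conj (w i.1.1) * w i.1.2 * (conj (w i.2.1) * w i.2.2)) ∂circularGaussian 1 := by
        refine integral_congr_ae (ae_of_all _ fun w => ?_)
        dsimp only
        rw [star_dotProduct_mulVec_eq_sum, star_dotProduct_mulVec_eq_sum, Finset.sum_mul_sum,
          ← Fintype.sum_prod_type']
        exact Finset.sum_congr rfl fun i _ => by ring
    _ = B.trace * D.trace + (B * D).trace := by
        rw [integral_finsetSum _ fun i _ =>
          (integrable_conj_mul_conj_mul i.1.1 i.1.2 i.2.1 i.2.2).const_mul _]
        simp_rw [integral_const_mul, integral_conj_mul_conj_mul, mul_add, Finset.sum_add_distrib,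
          Fintype.sum_prod_type]
        congr 1
        · simp [Matrix.trace, Finset.sum_mul_sum]
        · simp [Matrix.trace, Matrix.mul_apply]

omit [DecidableEq n] in
theorem star_mulVec_dotProduct_mulVec (R B : Matrix n n ℂ) (w : n → ℂ) :
    star (R *ᵥ w) ⬝ᵥ (B *ᵥ (R *ᵥ w)) = star w ⬝ᵥ ((Rᴴ * B * R) *ᵥ w) := by
  rw [Matrix.star_mulVec, ← Matrix.dotProduct_mulVec, Matrix.mulVec_mulVec, Matrix.mulVec_mulVec,
    Matrix.mul_assoc]

theorem integral_star_dotProduct_mulVec {C : Matrix n n ℂ} (hC : C.PosDef) (B : Matrix n n ℂ) :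
    ∫ y, star y ⬝ᵥ (B *ᵥ y) ∂circularGaussian C = (B * C).trace := by
  obtain ⟨R, hR, hRC⟩ := exists_isUnit_det_mul_conjTranspose_eq hC
  rw [← hRC, ← circularGaussian_one_map_mulVec hR, integral_map (by fun_prop) (by fun_prop)]
  simp_rw [star_mulVec_dotProduct_mulVec]
  rw [integral_star_dotProduct_mulVec_one, Matrix.mul_assoc, Matrix.trace_mul_comm,
    Matrix.mul_assoc]

theorem integral_star_dotProduct_mulVec_mul {C : Matrix n n ℂ} (hC : C.PosDef)
    (B D : Matrix n n ℂ) :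
    ∫ y, (star y ⬝ᵥ (B *ᵥ y)) * (star y ⬝ᵥ (D *ᵥ y)) ∂circularGaussian C =
      (B * C).trace * (D * C).trace + (B * C * (D * C)).trace := by
  obtain ⟨R, hR, hRC⟩ := exists_isUnit_det_mul_conjTranspose_eq hC
  have hcycle (E : Matrix n n ℂ) : (Rᴴ * E * R).trace = (E * (R * Rᴴ)).trace := by
    rw [Matrix.mul_assoc, Matrix.trace_mul_comm, Matrix.mul_assoc]
  rw [← hRC, ← circularGaussian_one_map_mulVec hR, integral_map (by fun_prop) (by fun_prop)]
  simp_rw [star_mulVec_dotProduct_mulVec]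
  rw [integral_star_dotProduct_mulVec_mul_one, hcycle, hcycle,
    show Rᴴ * B * R * (Rᴴ * D * R) = Rᴴ * (B * (R * Rᴴ) * D) * R by simp only [Matrix.mul_assoc],
    hcycle]
  simp only [Matrix.mul_assoc]

end Moments

section MatrixCalculus

variable {n : Type*} [Fintype n] [DecidableEq n] {A : ℝ → Matrix n n ℂ} {H : Matrix n n ℂ} {t : ℝ}

open scoped Matrix.Norms.Operator in
omit [Fintype n] [DecidableEq n] in
theorem hasDerivAt_matrix_iff [Finite n] :
    HasDerivAt A H t ↔ ∀ i j, HasDerivAt (fun s => A s i j) (H i j) t := by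
  classical
  have := Fintype.ofFinite n
  refine ⟨fun h i j =>
    (Matrix.entryLinearMap ℝ ℂ i j).toContinuousLinearMap.hasFDerivAt.comp_hasDerivAt t h,
    fun h => ?_⟩
  have hsum : HasDerivAt (fun s => ∑ i, ∑ j, A s i j • Matrix.single i j (1 : ℂ))
      (∑ i, ∑ j, H i j • Matrix.single i j (1 : ℂ)) t :=
    HasDerivAt.fun_sum fun i _ => HasDerivAt.fun_sum fun j _ => (h i j).smul_const _
  simpa [← Matrix.matrix_eq_sum_single] using hsum

open scoped Matrix.Norms.Operator in
theorem hasDerivAt_matrix_inv (hA : HasDerivAt A H t) (hunit : IsUnit (A t)) :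
    HasDerivAt (fun s => (A s)⁻¹) (-((A t)⁻¹ * H * (A t)⁻¹)) t := by
  obtain ⟨u, hu⟩ := hunit
  have h := (hasFDerivAt_ringInverse (𝕜 := ℝ) u).comp_hasDerivAt_of_eq t hA hu
  simp only [Function.comp_def, ← Matrix.nonsing_inv_eq_ringInverse,
    neg_apply, ContinuousLinearMap.mulLeftRight_apply, Matrix.coe_units_inv,
    hu] at h
  exact h

theorem hasDerivAt_matrix_det (hA : HasDerivAt A H t) :
    HasDerivAt (fun s => (A s).det) ((A t).adjugate * H).trace t := by
  let detCMM : ContinuousMultilinearMap ℂ (fun _ : n => n → ℂ) ℂ :=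
    { Matrix.detRowAlternating.toMultilinearMap with
      cont := (continuous_id (X := Matrix n n ℂ)).matrix_det }
  have hrows : HasDerivAt (fun s i j => A s i j) (fun i j => H i j) t :=
    hasDerivAt_pi.mpr fun i => hasDerivAt_pi.mpr (hasDerivAt_matrix_iff.mp hA i)
  have hdet := ((detCMM.hasFDerivAt fun i j => A t i j).restrictScalars ℝ).comp_hasDerivAt t hrows
  have hval : ∑ i, ((A t).updateRow i (H i)).det = ((A t).adjugate * H).trace := by
    rw [Matrix.trace_mul_comm]
    simp_rw [← Matrix.cramer_transpose_apply, Matrix.cramer_eq_adjugate_mulVec,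
      ← Matrix.adjugate_transpose]
    simp [Matrix.trace, Matrix.mul_apply, Matrix.mulVec, dotProduct, mul_comm]
  rw [← hval]
  refine hdet.congr_deriv ?_
  rw [ContinuousLinearMap.coe_restrictScalars', ContinuousMultilinearMap.linearDeriv_apply]
  rfl

end MatrixCalculus

theorem adjugate_eq_det_smul_inv {n R : Type*} [Fintype n] [DecidableEq n] [CommRing R]
    {A : Matrix n n R} (hA : IsUnit A) : A.adjugate = A.det • A⁻¹ := by
  have hdet := (Matrix.isUnit_iff_isUnit_det A).mp hA
  rw [Matrix.inv_def, smul_smul, Ring.mul_inverse_cancel _ hdet, one_smul]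

section Score

variable {n : Type*} [Fintype n] [DecidableEq n]

/-- The score of a circularly symmetric complex Gaussian law: the derivative of the log-density
when the covariance matrix `C` moves in the direction `H`. The real parts discard nothing when `C`
and `H` are Hermitian. -/
noncomputable def gaussianScore (C H : Matrix n n ℂ) (y : n → ℂ) : ℝ :=
  (star y ⬝ᵥ ((C⁻¹ * H * C⁻¹) *ᵥ y)).re - (C⁻¹ * H).trace.re

variable {A : ℝ → Matrix n n ℂ} {H : Matrix n n ℂ} {t : ℝ}

theorem hasDerivAt_gaussianDensity (hA : HasDerivAt A H t) (ht : (A t).PosDef) (y : n → ℂ) :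
    HasDerivAt (fun s => gaussianDensity (A s) y)
      (gaussianScore (A t) H y * gaussianDensity (A t) y) t := by
  have hdet : HasDerivAt (fun s => (A s).det.re) ((A t).det.re * ((A t)⁻¹ * H).trace.re) t := by
    have hdet_im : (A t).det.im = 0 := (Complex.pos_iff.mp ht.det_pos).2.symm
    refine (Complex.reCLM.hasFDerivAt.comp_hasDerivAt t (hasDerivAt_matrix_det hA)).congr_deriv ?_
    rw [adjugate_eq_det_smul_inv ht.isUnit, Matrix.smul_mul, Matrix.trace_smul, smul_eq_mul,
      Complex.reCLM_apply, Complex.mul_re, hdet_im, zero_mul, sub_zero]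
  have hquad : HasDerivAt (fun s => (star y ⬝ᵥ ((A s)⁻¹ *ᵥ y)).re)
      (-(star y ⬝ᵥ (((A t)⁻¹ * H * (A t)⁻¹) *ᵥ y)).re) t := by
    have hinv := hasDerivAt_matrix_iff.mp (hasDerivAt_matrix_inv hA ht.isUnit)
    have hsum := HasDerivAt.fun_sum (u := Finset.univ) fun (i : n × n) _ =>
      (hinv i.1 i.2).mul_const (star (y i.1) * y i.2)
    rw [← Complex.neg_re, ← dotProduct_neg, ← Matrix.neg_mulVec]
    simp_rw [star_dotProduct_mulVec_eq_sum]
    exact Complex.reCLM.hasFDerivAt.comp_hasDerivAt t hsum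
  have hpos := det_re_pos ht
  have hconst : HasDerivAt (fun s => 1 / (Real.pi ^ Fintype.card n * (A s).det.re))
      (-(1 / (Real.pi ^ Fintype.card n * (A t).det.re)) * ((A t)⁻¹ * H).trace.re) t := by
    simp_rw [one_div]
    refine ((hdet.const_mul _).inv (by positivity)).congr_deriv ?_
    field_simp
  refine (hconst.mul hquad.fun_neg.exp).congr_deriv ?_
  rw [gaussianScore, gaussianDensity]
  ring

theorem hasDerivAt_log_gaussianDensity (hA : HasDerivAt A H t) (ht : (A t).PosDef) (y : n → ℂ) :
    HasDerivAt (fun s => Real.log (gaussianDensity (A s) y)) (gaussianScore (A t) H y) t := by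
  have hpos := (gaussianDensity_pos ht y).ne'
  exact ((hasDerivAt_gaussianDensity hA ht y).log hpos).congr_deriv (mul_div_cancel_right₀ _ hpos)

section Information

variable {C H K : Matrix n n ℂ}

theorem ofReal_gaussianScore (hC : C.PosDef) (hH : H.IsHermitian) (y : n → ℂ) :
    (gaussianScore C H y : ℂ) =
      star y ⬝ᵥ ((C⁻¹ * H * C⁻¹) *ᵥ y) - (C⁻¹ * H * C⁻¹ * C).trace := by
  have hdet := (Matrix.isUnit_iff_isUnit_det C).mp hC.isUnit
  have hform : (C⁻¹ * H * C⁻¹).IsHermitian := by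
    simpa only [hC.isHermitian.inv.eq] using Matrix.isHermitian_mul_mul_conjTranspose C⁻¹ hH
  have htrace : star (C⁻¹ * H).trace = (C⁻¹ * H).trace := by
    rw [← Matrix.trace_conjTranspose, Matrix.conjTranspose_mul, hH.eq, hC.isHermitian.inv.eq,
      Matrix.trace_mul_comm]
  rw [Matrix.nonsing_inv_mul_cancel_right C _ hdet, gaussianScore, Complex.ofReal_sub,
    Complex.conj_eq_iff_re.mp htrace]
  congr 1
  exact Complex.ext rfl (hform.im_star_dotProduct_mulVec_self y).symm

theorem memLp_two_star_dotProduct_mulVec (hC : C.PosDef) (B : Matrix n n ℂ) :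
    MemLp (fun y => star y ⬝ᵥ (B *ᵥ y)) 2 (circularGaussian C) := by
  have hmeas : Continuous fun y : n → ℂ => star y ⬝ᵥ (B *ᵥ y) := by fun_prop
  refine (memLp_two_iff_integrable_sq_norm hmeas.aestronglyMeasurable).mpr ?_
  simpa only [← norm_pow] using (integrable_star_dotProduct_mulVec_pow hC B 2).norm

theorem integral_star_dotProduct_mulVec_sub_trace_mul (hC : C.PosDef) (B D : Matrix n n ℂ) :
    ∫ y, (star y ⬝ᵥ (B *ᵥ y) - (B * C).trace) * (star y ⬝ᵥ (D *ᵥ y) - (D * C).trace)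
      ∂circularGaussian C = (B * C * (D * C)).trace := by
  have : IsGaussian (circularGaussian C) := isGaussian_circularGaussian hC
  have hB := memLp_two_star_dotProduct_mulVec hC B
  have hD := memLp_two_star_dotProduct_mulVec hC D
  have hBD : Integrable (fun y => star y ⬝ᵥ (B *ᵥ y) * (star y ⬝ᵥ (D *ᵥ y))) (circularGaussian C) :=
    hB.integrable_mul hD
  have hBtr := (hB.integrable one_le_two).mul_const (D * C).trace
  have hDtr := (hD.integrable one_le_two).const_mul (B * C).trace
  simp_rw [sub_mul, mul_sub]
  rw [integral_sub (hBD.sub' hBtr) (hDtr.sub' (integrable_const _)), integral_sub hBD hBtr,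
    integral_sub hDtr (integrable_const _), integral_star_dotProduct_mulVec_mul hC,
    integral_mul_const, integral_const_mul, integral_star_dotProduct_mulVec hC,
    integral_star_dotProduct_mulVec hC, integral_const, probReal_univ, one_smul]
  ring

theorem memLp_two_gaussianScore (hC : C.PosDef) (H : Matrix n n ℂ) :
    MemLp (gaussianScore C H) 2 (circularGaussian C) := by
  have : IsGaussian (circularGaussian C) := isGaussian_circularGaussian hC
  exact (memLp_two_star_dotProduct_mulVec hC _).re.sub (memLp_const _)

theorem integral_gaussianScore_mul (hC : C.PosDef) (hH : H.IsHermitian) (hK : K.IsHermitian) :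
    ∫ y, gaussianScore C H y * gaussianScore C K y ∂circularGaussian C =
      (C⁻¹ * H * (C⁻¹ * K)).trace.re := by
  have hdet := (Matrix.isUnit_iff_isUnit_det C).mp hC.isUnit
  have hcomplex : ((∫ y, gaussianScore C H y * gaussianScore C K y ∂circularGaussian C : ℝ) : ℂ) =
      (C⁻¹ * H * (C⁻¹ * K)).trace := by
    rw [← integral_complex_ofReal]
    simp_rw [Complex.ofReal_mul, ofReal_gaussianScore hC hH, ofReal_gaussianScore hC hK]
    rw [integral_star_dotProduct_mulVec_sub_trace_mul hC,
      Matrix.nonsing_inv_mul_cancel_right C _ hdet,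
      Matrix.nonsing_inv_mul_cancel_right C _ hdet]
  rw [← hcomplex, Complex.ofReal_re]

end Information

end Score

section Regularity

variable {n : Type*} [Fintype n] [DecidableEq n] {C : Matrix n n ℂ}

theorem integrable_circularGaussian_iff {E : Type*} [NormedAddCommGroup E] [NormedSpace ℝ E]
    (hC : C.PosDef) {f : (n → ℂ) → E} :
    Integrable f (circularGaussian C) ↔ Integrable fun y => gaussianDensity C y • f y := by
  rw [circularGaussian, integrable_withDensity_iff_integrable_smul' (by fun_prop)
    (ae_of_all _ fun _ => ENNReal.ofReal_lt_top)]
  simp_rw [ENNReal.toReal_ofReal (gaussianDensity_pos hC _).le]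

theorem integral_circularGaussian {E : Type*} [NormedAddCommGroup E] [NormedSpace ℝ E]
    (hC : C.PosDef) (f : (n → ℂ) → E) :
    ∫ y, f y ∂circularGaussian C = ∫ y, gaussianDensity C y • f y := by
  rw [circularGaussian, integral_withDensity_eq_integral_toReal_smul (by fun_prop)
    (ae_of_all _ fun _ => ENNReal.ofReal_lt_top)]
  simp_rw [ENNReal.toReal_ofReal (gaussianDensity_pos hC _).le]

theorem volume_absolutelyContinuous_circularGaussian (hC : C.PosDef) :
    volume ≪ circularGaussian C := by
  refine withDensity_absolutelyContinuous' (by fun_prop) (ae_of_all _ fun y => ?_)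
  exact (ENNReal.ofReal_pos.mpr (gaussianDensity_pos hC y)).ne'

theorem exists_memLp_two_exp_mul_norm_sq (hC : C.PosDef) :
    ∃ η > 0, MemLp (fun y : n → ℂ => Real.exp (η * ‖y‖ ^ 2)) 2 (circularGaussian C) := by
  have : IsGaussian (circularGaussian C) := isGaussian_circularGaussian hC
  obtain ⟨η, hη, hint⟩ := IsGaussian.exists_integrable_exp_sq (circularGaussian C)
  have hmeas : Continuous fun y : n → ℂ => Real.exp (η / 2 * ‖y‖ ^ 2) := by fun_prop
  refine ⟨η / 2, half_pos hη, (memLp_two_iff_integrable_sq hmeas.aestronglyMeasurable).mpr ?_⟩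
  simp_rw [← Real.exp_nat_mul]
  exact hint.congr (ae_of_all _ fun y => congrArg Real.exp (by push_cast; ring))

omit [DecidableEq n] in
theorem eventually_norm_star_dotProduct_mulVec_le {X : Type*} {l : Filter X} {B : X → Matrix n n ℂ}
    {B₀ : Matrix n n ℂ} (hB : Tendsto B l (𝓝 B₀)) {c : ℝ} (hc : ∑ i : n × n, ‖B₀ i.1 i.2‖ < c) :
    ∀ᶠ a in l, ∀ y, ‖star y ⬝ᵥ (B a *ᵥ y)‖ ≤ c * ‖y‖ ^ 2 := by
  have hcont : Continuous fun B : Matrix n n ℂ => ∑ i : n × n, ‖B i.1 i.2‖ := by fun_prop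
  filter_upwards [((hcont.tendsto B₀).comp hB).eventually_lt_const hc] with a ha y
  exact (norm_star_dotProduct_mulVec_le (B a) y).trans
    (mul_le_mul_of_nonneg_right ha.le (by positivity))

variable {X : Type*} {l : Filter X} {A B : X → Matrix n n ℂ} {H : Matrix n n ℂ}

theorem tendsto_matrix_inv (hC : IsUnit C) (hA : Tendsto A l (𝓝 C)) :
    Tendsto (fun a => (A a)⁻¹) l (𝓝 C⁻¹) := by
  have hdet : C.det ≠ 0 := ((Matrix.isUnit_iff_isUnit_det C).mp hC).ne_zero
  refine (continuousAt_matrix_inv C ?_).tendsto.comp hA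
  rw [Ring.inverse_eq_inv']
  exact continuousAt_inv₀ hdet

theorem eventually_abs_gaussianScore_le (hC : IsUnit C) (hA : Tendsto A l (𝓝 C))
    (hB : Tendsto B l (𝓝 H)) :
    ∃ K > 0, ∀ᶠ a in l, ∀ y, |gaussianScore (A a) (B a) y| ≤ K * (‖y‖ ^ 2 + 1) := by
  have hinv := tendsto_matrix_inv hC hA
  have htrace : Tendsto (fun a => |((A a)⁻¹ * B a).trace.re|) l (𝓝 |(C⁻¹ * H).trace.re|) :=
    (Continuous.tendsto (f := fun D : Matrix n n ℂ => |D.trace.re|) (by fun_prop) _).comp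
      (hinv.mul hB)
  let quadBound : ℝ := ∑ i : n × n, ‖(C⁻¹ * H * C⁻¹) i.1 i.2‖
  let traceBound : ℝ := |(C⁻¹ * H).trace.re|
  have hquad_nonneg : 0 ≤ quadBound := by positivity
  have htrace_nonneg : 0 ≤ traceBound := abs_nonneg _
  refine ⟨quadBound + traceBound + 1, by positivity, ?_⟩
  filter_upwards [eventually_norm_star_dotProduct_mulVec_le ((hinv.mul hB).mul hinv)
    (lt_add_one quadBound), htrace.eventually_lt_const (lt_add_one traceBound)] with a hquad htr y
  calc |gaussianScore (A a) (B a) y|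
      ≤ |(star y ⬝ᵥ (((A a)⁻¹ * B a * (A a)⁻¹) *ᵥ y)).re| + |((A a)⁻¹ * B a).trace.re| :=
        abs_sub _ _
    _ ≤ (quadBound + 1) * ‖y‖ ^ 2 + (traceBound + 1) :=
        add_le_add ((Complex.abs_re_le_norm _).trans (hquad y)) htr.le
    _ ≤ (quadBound + traceBound + 1) * (‖y‖ ^ 2 + 1) := by
        nlinarith [mul_nonneg htrace_nonneg (sq_nonneg ‖y‖)]

theorem eventually_gaussianDensity_le (hC : C.PosDef) (hA : Tendsto A l (𝓝 C)) {η : ℝ}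
    (hη : 0 < η) :
    ∀ᶠ a in l, ∀ y,
      gaussianDensity (A a) y ≤ 2 * gaussianDensity C y * Real.exp (η * ‖y‖ ^ 2) := by
  have hdet : Tendsto (fun a => (A a).det.re) l (𝓝 C.det.re) :=
    (Continuous.tendsto (f := fun D : Matrix n n ℂ => D.det.re) (by fun_prop) _).comp hA
  have hinv : Tendsto (fun a => C⁻¹ - (A a)⁻¹) l (𝓝 0) := by
    simpa only [sub_self] using (tendsto_matrix_inv hC.isUnit hA).const_sub C⁻¹
  have hpos := det_re_pos hC
  filter_upwards [hdet.eventually_const_lt (half_lt_self hpos),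
    eventually_norm_star_dotProduct_mulVec_le hinv (c := η) (by simpa using hη)]
    with a hdet_lt hquad y
  have hexponent : -(star y ⬝ᵥ ((A a)⁻¹ *ᵥ y)).re ≤
      -(star y ⬝ᵥ (C⁻¹ *ᵥ y)).re + η * ‖y‖ ^ 2 := by
    have h := (Complex.re_le_norm _).trans (hquad y)
    rw [Matrix.sub_mulVec, dotProduct_sub, Complex.sub_re] at h
    linarith
  calc gaussianDensity (A a) y
      ≤ 1 / (Real.pi ^ Fintype.card n * (C.det.re / 2)) *
          Real.exp (-(star y ⬝ᵥ (C⁻¹ *ᵥ y)).re + η * ‖y‖ ^ 2) := by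
        unfold gaussianDensity
        gcongr
    _ = 2 * gaussianDensity C y * Real.exp (η * ‖y‖ ^ 2) := by
        rw [gaussianDensity, Real.exp_add]
        field_simp

theorem eventually_abs_gaussianScore_mul_gaussianDensity_le (hC : C.PosDef)
    (hA : Tendsto A l (𝓝 C)) (hpos : ∀ᶠ a in l, (A a).PosDef) (hB : Tendsto B l (𝓝 H)) {η : ℝ}
    (hη : 0 < η) :
    ∃ K, ∀ᶠ a in l, ∀ y, |gaussianScore (A a) (B a) y * gaussianDensity (A a) y| ≤
      K * (gaussianDensity C y * Real.exp (η * ‖y‖ ^ 2)) := by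
  obtain ⟨K, hK, hscore⟩ := eventually_abs_gaussianScore_le hC.isUnit hA hB
  refine ⟨K * (1 + (η / 2)⁻¹) * 2, ?_⟩
  filter_upwards [hscore, eventually_gaussianDensity_le hC hA (half_pos hη),
    hpos] with a hscore hdensity hpos y
  have hsplit : Real.exp (η * ‖y‖ ^ 2) =
      Real.exp (η / 2 * ‖y‖ ^ 2) * Real.exp (η / 2 * ‖y‖ ^ 2) := by
    rw [← Real.exp_add, ← add_mul, add_halves]
  have hpoly : ‖y‖ ^ 2 + 1 ≤ (1 + (η / 2)⁻¹) * Real.exp (η / 2 * ‖y‖ ^ 2) := by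
    have hexp := Real.add_one_le_exp (η / 2 * ‖y‖ ^ 2)
    have hone : 1 ≤ Real.exp (η / 2 * ‖y‖ ^ 2) := Real.one_le_exp (by positivity)
    have hsq : ‖y‖ ^ 2 ≤ (η / 2)⁻¹ * Real.exp (η / 2 * ‖y‖ ^ 2) := by
      rw [le_inv_mul_iff₀ (half_pos hη)]
      linarith
    linarith
  calc |gaussianScore (A a) (B a) y * gaussianDensity (A a) y|
      ≤ K * ((1 + (η / 2)⁻¹) * Real.exp (η / 2 * ‖y‖ ^ 2)) *
          (2 * gaussianDensity C y * Real.exp (η / 2 * ‖y‖ ^ 2)) := by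
        rw [abs_mul, abs_of_pos (gaussianDensity_pos hpos y)]
        have hdensity_nonneg := (gaussianDensity_pos hpos y).le
        gcongr
        · exact (hscore y).trans (mul_le_mul_of_nonneg_left hpoly hK.le)
        · exact hdensity y
    _ = K * (1 + (η / 2)⁻¹) * 2 * (gaussianDensity C y * Real.exp (η * ‖y‖ ^ 2)) := by
        rw [hsplit]
        ring

theorem hasDerivAt_integral_circularGaussian {A H : ℝ → Matrix n n ℂ} {t : ℝ}
    (hpos : ∀ᶠ s in 𝓝 t, (A s).PosDef) (hA : ∀ᶠ s in 𝓝 t, HasDerivAt A (H s) s)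
    (hH : ContinuousAt H t) {f : (n → ℂ) → ℝ} (hf : MemLp f 2 (circularGaussian (A t))) :
    HasDerivAt (fun s => ∫ y, f y ∂circularGaussian (A s))
      (∫ y, f y * gaussianScore (A t) (H t) y ∂circularGaussian (A t)) t := by
  have hpos_t := hpos.self_of_nhds
  have hf_meas : AEStronglyMeasurable f volume :=
    hf.1.mono_ac (volume_absolutelyContinuous_circularGaussian hpos_t)
  have hA_cont : ContinuousAt A t := continuousAt_pi.mpr fun i => continuousAt_pi.mpr fun j =>
    (hasDerivAt_matrix_iff.mp hA.self_of_nhds i j).continuousAt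
  obtain ⟨η, hη, hexp⟩ := exists_memLp_two_exp_mul_norm_sq hpos_t
  obtain ⟨K, hK⟩ := eventually_abs_gaussianScore_mul_gaussianDensity_le hpos_t
    hA_cont.tendsto hpos hH.tendsto hη
  have : IsGaussian (circularGaussian (A t)) := isGaussian_circularGaussian hpos_t
  have hbound : Integrable
      (fun y => K * (gaussianDensity (A t) y • (|f y| * Real.exp (η * ‖y‖ ^ 2)))) :=
    ((integrable_circularGaussian_iff hpos_t).mp (hf.abs.integrable_mul hexp)).const_mul K
  have hint : Integrable (fun y => gaussianDensity (A t) y * f y) :=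
    (integrable_circularGaussian_iff hpos_t).mp (hf.integrable one_le_two)
  have hderiv := (hasDerivAt_integral_of_dominated_loc_of_deriv_le
    (F := fun s y => gaussianDensity (A s) y * f y)
    (F' := fun s y => gaussianScore (A s) (H s) y * gaussianDensity (A s) y * f y)
    (hpos.and (hA.and hK)) (Eventually.of_forall fun s => by fun_prop) hint
    (by unfold gaussianScore; fun_prop) (ae_of_all _ fun y s hs => ?_) hbound
    (ae_of_all _ fun y s hs => (hasDerivAt_gaussianDensity hs.2.1 hs.1 y).mul_const (f y))).2
  · rw [integral_circularGaussian hpos_t]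
    refine (hderiv.congr_of_eventuallyEq ?_).congr_deriv ?_
    · filter_upwards [hpos] with s hs
      exact integral_circularGaussian hs f
    · exact integral_congr_ae (ae_of_all _ fun y => by simp only [smul_eq_mul]; ring)
  · calc ‖gaussianScore (A s) (H s) y * gaussianDensity (A s) y * f y‖
        ≤ K * (gaussianDensity (A t) y * Real.exp (η * ‖y‖ ^ 2)) * |f y| := by
          rw [norm_mul]
          exact mul_le_mul_of_nonneg_right (hs.2.2 y) (abs_nonneg _)
      _ = K * (gaussianDensity (A t) y • (|f y| * Real.exp (η * ‖y‖ ^ 2))) := by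
          rw [smul_eq_mul]
          ring

end Regularity

section CramerRao

open scoped RealInnerProductSpace

variable {ι : Type*} [Fintype ι] [DecidableEq ι]

theorem trace_inv_gram_le_sum_norm_sq {V : Type*} [NormedAddCommGroup V] [InnerProductSpace ℝ V]
    {u z : ι → V} (hgram : IsUnit (Matrix.gram ℝ z))
    (hbiorth : ∀ i p, ⟪u i, z p⟫ = if i = p then 1 else 0) :
    (Matrix.gram ℝ z)⁻¹.trace ≤ ∑ i, ‖u i‖ ^ 2 := by
  set J := Matrix.gram ℝ z
  have hinv : J⁻¹ * J = 1 := Matrix.nonsing_inv_mul _ ((Matrix.isUnit_iff_isUnit_det J).mp hgram)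
  refine Finset.sum_le_sum fun i _ => ?_
  let w : V := ∑ p, J⁻¹ i p • z p
  have huw : ⟪u i, w⟫ = J⁻¹ i i := by
    simp [w, inner_sum, real_inner_smul_right, hbiorth]
  have hwz (q : ι) : ⟪w, z q⟫ = if i = q then 1 else 0 := by
    simp only [w, sum_inner, real_inner_smul_left]
    exact (Matrix.mul_apply (M := J⁻¹) (N := J)).symm.trans (by rw [hinv, Matrix.one_apply])
  have hww : ‖w‖ ^ 2 = J⁻¹ i i := by
    rw [← real_inner_self_eq_norm_sq]
    conv_lhs => rw [show ⟪w, w⟫ = ⟪w, ∑ p, J⁻¹ i p • z p⟫ from rfl]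
    simp [inner_sum, real_inner_smul_right, hwz]
  have hcs := norm_sub_sq_real (u i) w
  rw [huw, hww] at hcs
  rw [Matrix.diag_apply]
  linarith [sq_nonneg ‖u i - w‖]

theorem trace_inv_le_integral_norm_sq {E : Type*} [MeasurableSpace E] {ν : Measure E}
    {T : E → EuclideanSpace ℝ ι} {Z : ι → E → ℝ} {J : Matrix ι ι ℝ} (hJ : IsUnit J)
    (hT : MemLp T 2 ν) (hZ : ∀ p, MemLp (Z p) 2 ν)
    (hcov : ∀ i p, ∫ y, T y i * Z p y ∂ν = if i = p then 1 else 0)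
    (hfisher : ∀ p q, ∫ y, Z p y * Z q y ∂ν = J p q) :
    J⁻¹.trace ≤ ∫ y, ‖T y‖ ^ 2 ∂ν := by
  have hcoord (i : ι) : MemLp (fun y => T y i) 2 ν := hT.eval_piLp i
  have hinner {f g : E → ℝ} (hf : MemLp f 2 ν) (hg : MemLp g 2 ν) :
      ⟪hf.toLp f, hg.toLp g⟫ = ∫ y, f y * g y ∂ν := by
    rw [L2.inner_def]
    refine integral_congr_ae ?_
    filter_upwards [hf.coeFn_toLp, hg.coeFn_toLp] with y hfy hgy
    rw [hfy, hgy, RCLike.inner_apply, conj_trivial, mul_comm]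
  have hgram : Matrix.gram ℝ (fun p => (hZ p).toLp (Z p)) = J := by
    ext p q
    rw [Matrix.gram_apply, hinner, hfisher]
  have h := trace_inv_gram_le_sum_norm_sq (u := fun i => (hcoord i).toLp _) (hgram ▸ hJ)
    fun i p => (hinner (hcoord i) (hZ p)).trans (hcov i p)
  rw [hgram] at h
  refine h.trans_eq ?_
  simp_rw [← real_inner_self_eq_norm_sq ((hcoord _).toLp _), hinner, EuclideanSpace.real_norm_sq_eq,
    ← pow_two]
  exact (integral_finsetSum _ fun i _ => (hcoord i).integrable_sq).symm

variable {n : Type*} [Fintype n] [DecidableEq n]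

omit [Fintype n] [DecidableEq n] in
theorem isHermitian_of_hasDerivAt [Finite n] {A : ℝ → Matrix n n ℂ} {H : Matrix n n ℂ} {t : ℝ}
    (hA : ∀ᶠ s in 𝓝 t, (A s).IsHermitian) (hderiv : HasDerivAt A H t) : H.IsHermitian := by
  rw [hasDerivAt_matrix_iff] at hderiv
  refine Matrix.IsHermitian.ext fun i j => (hderiv j i).star.unique ?_
  refine (hderiv i j).congr_of_eventuallyEq ?_
  filter_upwards [hA] with s hs
  exact hs.apply i j

/-- The Fisher information matrix of a circularly symmetric complex Gaussian law whose covariance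
matrix `C` has partial derivatives `H p`. The traces are real when `C` and the `H p` are
Hermitian. -/
noncomputable def gaussianFisher (C : Matrix n n ℂ) (H : ι → Matrix n n ℂ) : Matrix ι ι ℝ :=
  Matrix.of fun p q => (C⁻¹ * H p * (C⁻¹ * H q)).trace.re

omit [Fintype ι] [DecidableEq ι] in
theorem ofReal_gaussianFisher {C : Matrix n n ℂ} {H : ι → Matrix n n ℂ} (hC : C.IsHermitian)
    (hH : ∀ p, (H p).IsHermitian) (p q : ι) :
    ((gaussianFisher C H p q : ℝ) : ℂ) = (C⁻¹ * H p * (C⁻¹ * H q)).trace := by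
  refine Complex.conj_eq_iff_re.mp ?_
  rw [starRingEnd_apply, ← Matrix.trace_conjTranspose]
  simp only [Matrix.conjTranspose_mul, hC.inv.eq, (hH _).eq, Matrix.mul_assoc]
  rw [Matrix.trace_mul_comm]
  simp only [Matrix.mul_assoc]

variable {C : EuclideanSpace ℝ ι → Matrix n n ℂ} {H : ι → EuclideanSpace ℝ ι → Matrix n n ℂ}
  {x : EuclideanSpace ℝ ι} {F : (n → ℂ) → EuclideanSpace ℝ ι}

-- Differentiating `E_{x + t e_p} [F_i - x_i] = t δ_{ip}` at `t = 0` produces the score.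
theorem integral_sub_mul_gaussianScore (hC : ∀ᶠ x' in 𝓝 x, (C x').PosDef) {p : ι}
    (hderiv : ∀ᶠ x' in 𝓝 x,
      HasDerivAt (fun t : ℝ => C (x' + t • EuclideanSpace.single p 1)) (H p x') 0)
    (hH : ContinuousAt (H p) x)
    (hunbiased : ∀ᶠ x' in 𝓝 x, Integrable F (circularGaussian (C x')) ∧
      ∫ v, F v ∂circularGaussian (C x') = x')
    (hF : MemLp (fun v => F v - x) 2 (circularGaussian (C x))) (i : ι) :
    ∫ v, (F v - x) i * gaussianScore (C x) (H p x) v ∂circularGaussian (C x) =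
      if i = p then 1 else 0 := by
  let line (t : ℝ) : EuclideanSpace ℝ ι := x + t • EuclideanSpace.single p 1
  have hline_zero : line 0 = x := by simp [line]
  have hline_cont : Continuous line := by fun_prop
  have hline : Tendsto line (𝓝 0) (𝓝 x) := hline_zero ▸ hline_cont.tendsto 0
  have hcurve : ∀ᶠ t in 𝓝 0, HasDerivAt (fun t => C (line t)) (H p (line t)) t := by
    filter_upwards [hline.eventually hderiv] with t ht
    rw [← sub_self t, hasDerivAt_matrix_iff] at ht
    refine hasDerivAt_matrix_iff.mpr fun j k =>
      ((ht j k).comp_sub_const t t).congr_of_eventuallyEq (.of_forall fun s => ?_)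
    simp only [line, add_assoc, ← add_smul, add_sub_cancel]
  have hmean : (fun t => ∫ v, (F v - x) i ∂circularGaussian (C (line t))) =ᶠ[𝓝 0]
      fun t => t * if i = p then 1 else 0 := by
    filter_upwards [hline.eventually hC, hline.eventually hunbiased] with t hpos ⟨hint, hmean⟩
    have : IsGaussian (circularGaussian (C (line t))) := isGaussian_circularGaussian hpos
    have hcoord := (EuclideanSpace.proj i).integral_comp_comm (𝕜 := ℝ)
      (hint.sub (integrable_const x))
    refine hcoord.trans ?_
    simp only [Pi.sub_apply]
    rw [integral_sub hint (integrable_const x), hmean, integral_const, probReal_univ, one_smul,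
      add_sub_cancel_left]
    simp [PiLp.single_apply]
  have hscore := hasDerivAt_integral_circularGaussian (hline.eventually hC) hcurve
    (hH.comp_of_eq hline_cont.continuousAt hline_zero) (hline_zero.symm ▸ hF.eval_piLp i)
  rw [hline_zero] at hscore
  refine hscore.unique (HasDerivAt.congr_of_eventuallyEq ?_ hmean)
  exact hasDerivAt_mul_const _

theorem trace_inv_gaussianFisher_le (hC : ∀ᶠ x' in 𝓝 x, (C x').PosDef)
    (hderiv : ∀ p, ∀ᶠ x' in 𝓝 x,
      HasDerivAt (fun t : ℝ => C (x' + t • EuclideanSpace.single p 1)) (H p x') 0)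
    (hH : ∀ p, ContinuousAt (H p) x)
    (hunbiased : ∀ᶠ x' in 𝓝 x, Integrable F (circularGaussian (C x')) ∧
      ∫ v, F v ∂circularGaussian (C x') = x')
    (hfisher : IsUnit (gaussianFisher (C x) (H · x))) :
    ENNReal.ofReal (gaussianFisher (C x) (H · x))⁻¹.trace ≤
      ∫⁻ v, ENNReal.ofReal (‖F v - x‖ ^ 2) ∂circularGaussian (C x) := by
  have hCx := hC.self_of_nhds
  have : IsGaussian (circularGaussian (C x)) := isGaussian_circularGaussian hCx
  by_cases hfin : ∫⁻ v, ENNReal.ofReal (‖F v - x‖ ^ 2) ∂circularGaussian (C x) = ⊤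
  · exact hfin ▸ le_top
  have herror_meas : AEStronglyMeasurable (fun v => F v - x) (circularGaussian (C x)) :=
    hunbiased.self_of_nhds.1.aestronglyMeasurable.sub aestronglyMeasurable_const
  have hsq_int : Integrable (fun v => ‖F v - x‖ ^ 2) (circularGaussian (C x)) :=
    (lintegral_ofReal_ne_top_iff_integrable (by fun_prop)
      (ae_of_all _ fun v => by positivity)).mp hfin
  have herror : MemLp (fun v => F v - x) 2 (circularGaussian (C x)) :=
    (memLp_two_iff_integrable_sq_norm herror_meas).mpr hsq_int
  have hherm (p : ι) : (H p x).IsHermitian := by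
    refine isHermitian_of_hasDerivAt ?_ (hderiv p).self_of_nhds
    have hline : Continuous fun t : ℝ => x + t • EuclideanSpace.single p (1 : ℝ) := by fun_prop
    refine ((hline.tendsto' 0 x (by simp)).eventually hC).mono fun t ht => ht.isHermitian
  rw [← ofReal_integral_eq_lintegral_ofReal hsq_int (ae_of_all _ fun v => by positivity)]
  exact ENNReal.ofReal_le_ofReal (trace_inv_le_integral_norm_sq hfisher herror
    (fun p => memLp_two_gaussianScore hCx (H p x))
    (fun i p => integral_sub_mul_gaussianScore hC (hderiv p) (hH p) hunbiased herror i)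
    fun p q => integral_gaussianScore_mul hCx (hherm p) (hherm q))

end CramerRao

section RankOne

variable {n 𝕜 : Type*} [Fintype n] [DecidableEq n] [Field 𝕜] {c s : 𝕜} {u v : n → 𝕜}

theorem det_smul_vecMulVec_add_smul_one (c : 𝕜) (u v : n → 𝕜) (hs : s ≠ 0) :
    (c • Matrix.vecMulVec u v + s • (1 : Matrix n n 𝕜)).det =
      s ^ Fintype.card n * (1 + c / s * (v ⬝ᵥ u)) := by
  have hfactor : c • Matrix.vecMulVec u v + s • (1 : Matrix n n 𝕜) =
      s • (1 + Matrix.replicateCol Unit ((c / s) • u) * Matrix.replicateRow Unit v) := by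
    rw [← Matrix.vecMulVec_eq, Matrix.smul_vecMulVec, smul_add, smul_smul, mul_div_cancel₀ _ hs,
      add_comm]
  rw [hfactor, Matrix.det_smul, Matrix.det_one_add_replicateCol_mul_replicateRow,
    dotProduct_smul, smul_eq_mul]

theorem inv_smul_vecMulVec_add_smul_one (hs : s ≠ 0) (htop : s + c * (v ⬝ᵥ u) ≠ 0) :
    (c • Matrix.vecMulVec u v + s • (1 : Matrix n n 𝕜))⁻¹ =
      s⁻¹ • (1 - (c / (s + c * (v ⬝ᵥ u))) • Matrix.vecMulVec u v) := by
  apply Matrix.inv_eq_right_inv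
  have hsq : Matrix.vecMulVec u v * Matrix.vecMulVec u v = (v ⬝ᵥ u) • Matrix.vecMulVec u v := by
    rw [Matrix.vecMulVec_mul_vecMulVec, Matrix.vecMulVec_smul]
  simp only [mul_smul_comm, add_mul, mul_sub, smul_mul_assoc, hsq, mul_one, one_mul, smul_smul,
    smul_add, smul_sub]
  match_scalars
  · field_simp
    ring
  · field_simp

omit [DecidableEq n] in
theorem trace_mul_vecMulVec (A : Matrix n n 𝕜) (u v : n → 𝕜) :
    (A * Matrix.vecMulVec u v).trace = v ⬝ᵥ (A *ᵥ u) := by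
  rw [Matrix.mul_vecMulVec, Matrix.trace_vecMulVec, dotProduct_comm]

theorem trace_inv_smul_vecMulVec_add_mul (hs : s ≠ 0) (htop : s + c * (v ⬝ᵥ u) ≠ 0)
    (A B : Matrix n n 𝕜) :
    ((c • Matrix.vecMulVec u v + s • (1 : Matrix n n 𝕜))⁻¹ * A *
        ((c • Matrix.vecMulVec u v + s • (1 : Matrix n n 𝕜))⁻¹ * B)).trace =
      (s ^ 2)⁻¹ * ((A * B).trace - c / (s + c * (v ⬝ᵥ u)) * (v ⬝ᵥ ((A * B + B * A) *ᵥ u)) +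
        (c / (s + c * (v ⬝ᵥ u))) ^ 2 * (v ⬝ᵥ (A *ᵥ u)) * (v ⬝ᵥ (B *ᵥ u))) := by
  set P := Matrix.vecMulVec u v with hP
  have hfirst : (P * A * B).trace = v ⬝ᵥ ((A * B) *ᵥ u) := by
    rw [Matrix.mul_assoc, Matrix.trace_mul_comm, trace_mul_vecMulVec]
  have hsecond : (A * (P * B)).trace = v ⬝ᵥ ((B * A) *ᵥ u) := by
    rw [← Matrix.mul_assoc, Matrix.trace_mul_comm, ← Matrix.mul_assoc, trace_mul_vecMulVec]
  have hboth : (P * A * (P * B)).trace = v ⬝ᵥ (A *ᵥ u) * (v ⬝ᵥ (B *ᵥ u)) := by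
    have hcycle : (P * A * (P * B)).trace = (A * P * (B * P)).trace := by
      rw [Matrix.mul_assoc, Matrix.trace_mul_comm]
      simp only [Matrix.mul_assoc]
    rw [hcycle, hP, Matrix.mul_vecMulVec, Matrix.mul_vecMulVec, Matrix.vecMulVec_mul_vecMulVec,
      Matrix.vecMulVec_smul, Matrix.trace_smul, Matrix.trace_vecMulVec, smul_eq_mul, mul_comm,
      dotProduct_comm _ v]
  rw [inv_smul_vecMulVec_add_smul_one hs htop]
  simp only [smul_mul_assoc, mul_smul_comm, sub_mul, mul_sub, one_mul, ← hP, Matrix.trace_smul,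
    Matrix.trace_sub, smul_sub, smul_eq_mul, hfirst, hsecond, hboth, Matrix.add_mulVec,
    dotProduct_add]
  ring

omit [DecidableEq n] in
theorem dotProduct_vecMulVec_mulVec (w a b z : n → 𝕜) :
    w ⬝ᵥ (Matrix.vecMulVec a b *ᵥ z) = (w ⬝ᵥ a) * (b ⬝ᵥ z) := by
  rw [Matrix.vecMulVec_mulVec, dotProduct_smul, op_smul_eq_mul]

-- `A` and `B` have the shape of derivatives of `u vᵀ` along curves of vectors `u` and `v`.
theorem sq_mul_trace_inv_mul_eq (hs : s ≠ 0) (hc : c ≠ 0) (htop : s + c * (v ⬝ᵥ u) ≠ 0)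
    {A B : Matrix n n 𝕜} {a a' b b' : n → 𝕜}
    (hA : A = Matrix.vecMulVec a v + Matrix.vecMulVec u a')
    (hB : B = Matrix.vecMulVec b v + Matrix.vecMulVec u b') :
    c ^ 2 * ((c • Matrix.vecMulVec u v + s • (1 : Matrix n n 𝕜))⁻¹ * A *
        ((c • Matrix.vecMulVec u v + s • (1 : Matrix n n 𝕜))⁻¹ * B)).trace =
      c ^ 3 / (s * (s + c * (v ⬝ᵥ u)) ^ 2) *
        (-2 * (v ⬝ᵥ u) * (v ⬝ᵥ a + a' ⬝ᵥ u) * (v ⬝ᵥ b + b' ⬝ᵥ u) + s / c * (A * B).trace +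
          v ⬝ᵥ ((A * B + B * A) *ᵥ u)) := by
  have hquad {D : Matrix n n 𝕜} {d d' : n → 𝕜}
      (hD : D = Matrix.vecMulVec d v + Matrix.vecMulVec u d') :
      v ⬝ᵥ (D *ᵥ u) = (v ⬝ᵥ u) * (v ⬝ᵥ d + d' ⬝ᵥ u) := by
    simp only [hD, Matrix.add_mulVec, dotProduct_add, dotProduct_vecMulVec_mulVec]
    ring
  have hanti : v ⬝ᵥ ((A * B + B * A) *ᵥ u) =
      (v ⬝ᵥ u) * ((A * B).trace + (v ⬝ᵥ a + a' ⬝ᵥ u) * (v ⬝ᵥ b + b' ⬝ᵥ u)) := by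
    simp only [hA, hB, mul_add, add_mul, Matrix.vecMulVec_mul_vecMulVec, Matrix.vecMulVec_smul,
      Matrix.trace_add, Matrix.trace_smul, Matrix.trace_vecMulVec, Matrix.add_mulVec,
      Matrix.smul_mulVec, dotProduct_add, dotProduct_smul, dotProduct_vecMulVec_mulVec,
      smul_eq_mul, dotProduct_comm _ v, dotProduct_comm u, dotProduct_comm a b']
    ring
  rw [trace_inv_smul_vecMulVec_add_mul hs htop, hquad hA, hquad hB, hanti]
  field_simp
  ring

end RankOne

section PartialDerivative

variable {E : Type*} [NormedAddCommGroup E] [NormedSpace ℝ E]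
  {f : EuclideanSpace ℝ (Fin 2) → E} {x : EuclideanSpace ℝ (Fin 2)} {p : Fin 2}

theorem hasDerivAt_partialD (hf : DifferentiableAt ℝ f x) (p : Fin 2) :
    HasDerivAt (fun t : ℝ => f (x + t • EuclideanSpace.single p (1 : ℝ))) (partialD f p x) 0 :=
  hf.lineDifferentiableAt.hasLineDerivAt

theorem partialD_eq {f' : E}
    (h : HasDerivAt (fun t : ℝ => f (x + t • EuclideanSpace.single p (1 : ℝ))) f' 0) :
    partialD f p x = f' :=
  HasLineDerivAt.lineDeriv h

theorem continuous_partialD (hf : ContDiff ℝ 1 f) (p : Fin 2) : Continuous (partialD f p) := by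
  have hpartial : partialD f p = fun x => fderiv ℝ f x (EuclideanSpace.single p (1 : ℝ)) :=
    funext fun x => (hf.differentiable one_ne_zero x).lineDeriv_eq_fderiv
  rw [hpartial]
  exact (hf.continuous_fderiv one_ne_zero).clm_apply continuous_const

end PartialDerivative

variable {M N : ℕ} (W : Matrix (Fin M × Fin N) (Fin 3) ℂ) (x : EuclideanSpace ℝ (Fin 2))

section Gain

/-- The partial derivative `∂g/∂x_p` of `g = Wᴴ a(x)`, entry by entry. -/
noncomputable def gDeriv (p : Fin 2) : Fin 3 → ℂ :=
  fun i => partialD (fun x' => gVec W x' i) p x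

theorem contDiff_steering (q : Fin M × Fin N) : ContDiff ℝ 1 fun x => steering M N x q := by
  have hcoord (i : Fin 2) : ContDiff ℝ 1 fun x : EuclideanSpace ℝ (Fin 2) => x i :=
    (EuclideanSpace.proj (𝕜 := ℝ) i).contDiff
  have hsteering₁ {K : ℕ} (m : Fin K) : ContDiff ℝ 1 fun t => steering₁ K t m :=
    (contDiff_const.mul (Complex.ofRealCLM.contDiff.comp (contDiff_const.mul contDiff_id))).cexp
  exact ((hsteering₁ q.1).comp (hcoord 0)).mul ((hsteering₁ q.2).comp (hcoord 1))

theorem contDiff_gVec (i : Fin 3) : ContDiff ℝ 1 fun x => gVec W x i :=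
  ContDiff.sum fun q _ => contDiff_const.mul (contDiff_steering q)

theorem contDiff_gOuter (i j : Fin 3) : ContDiff ℝ 1 fun x => gOuter W x i j :=
  (contDiff_gVec W i).mul (Complex.conjCLE.contDiff.comp (contDiff_gVec W j))

theorem hasDerivAt_gVec (p : Fin 2) (i : Fin 3) :
    HasDerivAt (fun t : ℝ => gVec W (x + t • EuclideanSpace.single p (1 : ℝ)) i) (gDeriv W x p i)
      0 :=
  hasDerivAt_partialD ((contDiff_gVec W i).differentiable one_ne_zero x) p

theorem hasDerivAt_gOuter (p : Fin 2) :
    HasDerivAt (fun t : ℝ => gOuter W (x + t • EuclideanSpace.single p (1 : ℝ))) (gMat W x p) 0 :=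
  hasDerivAt_matrix_iff.mpr fun i j =>
    hasDerivAt_partialD ((contDiff_gOuter W i j).differentiable one_ne_zero x) p

theorem continuous_gMat (p : Fin 2) : Continuous (gMat W · p) :=
  continuous_matrix fun i j => continuous_partialD (contDiff_gOuter W i j) p

theorem gMat_eq_vecMulVec_add (p : Fin 2) :
    gMat W x p = Matrix.vecMulVec (gDeriv W x p) (star (gVec W x)) +
      Matrix.vecMulVec (gVec W x) (star (gDeriv W x p)) := by
  ext i j
  have hprod := (hasDerivAt_gVec W x p i).mul (hasDerivAt_gVec W x p j).star
  refine (partialD_eq (f := fun x' => gOuter W x' i j) hprod).trans ?_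
  simp [Matrix.vecMulVec_apply]

theorem contDiff_gSq : ContDiff ℝ 1 (gSq W) :=
  ContDiff.sum fun i _ => (contDiff_gVec W i).norm_sq ℝ

theorem ofReal_gSq : (gSq W x : ℂ) = star (gVec W x) ⬝ᵥ gVec W x := by
  simp [gSq, dotProduct, ← Complex.normSq_eq_norm_sq, Complex.normSq_eq_conj_mul_self]

theorem ofReal_gTilde (p : Fin 2) :
    (gTilde W x p : ℂ) = star (gVec W x) ⬝ᵥ gDeriv W x p + star (gDeriv W x p) ⬝ᵥ gVec W x := by
  have hreal :=
    (hasDerivAt_partialD ((contDiff_gSq W).differentiable one_ne_zero x) p).ofReal_comp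
  have htrace := HasDerivAt.fun_sum (u := Finset.univ) fun i _ =>
    hasDerivAt_matrix_iff.mp (hasDerivAt_gOuter W x p) i i
  have hgTilde : (gTilde W x p : ℂ) = (gMat W x p).trace := by
    refine hreal.unique (htrace.congr_of_eventuallyEq (.of_forall fun t => ?_))
    simp only [ofReal_gSq, gOuter, Matrix.vecMulVec_apply, dotProduct, mul_comm]
  rw [hgTilde, gMat_eq_vecMulVec_add, Matrix.trace_add, Matrix.trace_vecMulVec,
    Matrix.trace_vecMulVec, dotProduct_comm, dotProduct_comm (gVec W x)]

end Gain

section Covariance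

variable {S σβ σz : ℝ} (p j : Fin 2)

/-- The partial derivative `∂Σ/∂x_p` of the covariance matrix `covDI`, written through the
derivative `gMat` of `g gᴴ`. -/
noncomputable def covDIDeriv (S σβ : ℝ) : Matrix (Fin 3) (Fin 3) ℂ :=
  ((S ^ 2 * σβ ^ 2 : ℝ) : ℂ) • gMat W x p

theorem continuous_covDIDeriv (S σβ : ℝ) : Continuous (covDIDeriv W · p S σβ) :=
  (continuous_gMat W p).fun_const_smul _

theorem hasDerivAt_covDI (S σβ σz : ℝ) :
    HasDerivAt (fun t : ℝ => covDI S σβ σz W (x + t • EuclideanSpace.single p (1 : ℝ)))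
      (covDIDeriv W x p S σβ) 0 :=
  hasDerivAt_matrix_iff.mpr fun i j =>
    ((hasDerivAt_matrix_iff.mp (hasDerivAt_gOuter W x p) i j).const_smul
      ((S ^ 2 * σβ ^ 2 : ℝ) : ℂ)).add_const _

theorem posDef_covDI (S σβ : ℝ) (hσz : σz ≠ 0) : (covDI S σβ σz W x).PosDef := by
  refine Matrix.PosDef.posSemidef_add ?_ ?_
  · exact (Matrix.posSemidef_vecMulVec_self_star _).smul (by positivity)
  · exact Matrix.PosDef.one.smul (by positivity)

theorem isHermitian_covDIDeriv (S σβ : ℝ) : (covDIDeriv W x p S σβ).IsHermitian :=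
  isHermitian_of_hasDerivAt
    (.of_forall fun _ => (posDef_covDI W _ S σβ one_ne_zero).isHermitian)
    (hasDerivAt_covDI W x p S σβ 1)

theorem gaussianDensity_covDI (S σβ σz : ℝ) :
    gaussianDensity (covDI S σβ σz W x) = pDI S σβ σz W x := by
  ext y
  rw [gaussianDensity, pDI, Fintype.card_fin]

theorem scoreDI_eq_gaussianScore (S σβ : ℝ) (hσz : σz ≠ 0) :
    scoreDI S σβ σz W x p = gaussianScore (covDI S σβ σz W x) (covDIDeriv W x p S σβ) := by
  ext y
  refine partialD_eq ?_
  simp_rw [← gaussianDensity_covDI]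
  have hpos := posDef_covDI W (x + (0 : ℝ) • EuclideanSpace.single p 1) S σβ hσz
  simpa using hasDerivAt_log_gaussianDensity (hasDerivAt_covDI W x p S σβ σz) hpos y

theorem integrable_scoreDI_mul_scoreDI_mul_pDI (S σβ : ℝ) (hσz : σz ≠ 0) :
    Integrable fun y => scoreDI S σβ σz W x p y * scoreDI S σβ σz W x j y * pDI S σβ σz W x y := by
  have hC := posDef_covDI W x S σβ hσz
  have hint := (memLp_two_gaussianScore hC (covDIDeriv W x p S σβ)).integrable_mul
    (memLp_two_gaussianScore hC (covDIDeriv W x j S σβ))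
  rw [integrable_circularGaussian_iff hC, gaussianDensity_covDI] at hint
  simpa only [scoreDI_eq_gaussianScore W x _ S σβ hσz, mul_comm, smul_eq_mul, Pi.mul_apply]
    using hint

theorem fisherDI_eq_gaussianFisher (S σβ : ℝ) (hσz : σz ≠ 0) :
    fisherDI S σβ σz W x =
      gaussianFisher (covDI S σβ σz W x) (covDIDeriv W x · S σβ) := by
  ext p j
  have hC := posDef_covDI W x S σβ hσz
  rw [gaussianFisher, Matrix.of_apply, ← integral_gaussianScore_mul hC
    (isHermitian_covDIDeriv W x p S σβ) (isHermitian_covDIDeriv W x j S σβ),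
    integral_circularGaussian hC, gaussianDensity_covDI]
  simp only [fisherDI, Matrix.of_apply, scoreDI_eq_gaussianScore W x _ S σβ hσz, smul_eq_mul,
    mul_comm]

theorem ofReal_fisherDI (hS : S ≠ 0) (hσβ : σβ ≠ 0) (hσz : σz ≠ 0) :
    ((fisherDI S σβ σz W x p j : ℝ) : ℂ) =
      (σz ^ 6 * S ^ 6 * σβ ^ 6 : ℝ) / (covDI S σβ σz W x).det ^ 2 *
        (-2 * (gSq W x : ℂ) * (gTilde W x p : ℂ) * (gTilde W x j : ℂ)
          + ((σz ^ 2 / (S ^ 2 * σβ ^ 2) : ℝ) : ℂ) * (gMat W x p * gMat W x j).trace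
          + star (gVec W x) ⬝ᵥ
              ((gMat W x p * gMat W x j + gMat W x j * gMat W x p) *ᵥ gVec W x)) := by
  have hσz2 : ((σz ^ 2 : ℝ) : ℂ) ≠ 0 := by exact_mod_cast pow_ne_zero 2 hσz
  have hgain : ((S ^ 2 * σβ ^ 2 : ℝ) : ℂ) ≠ 0 := by
    exact_mod_cast mul_ne_zero (pow_ne_zero 2 hS) (pow_ne_zero 2 hσβ)
  have hdet : (covDI S σβ σz W x).det = ((σz ^ 2 : ℝ) : ℂ) ^ 2 *
      (((σz ^ 2 : ℝ) : ℂ) + ((S ^ 2 * σβ ^ 2 : ℝ) : ℂ) * (star (gVec W x) ⬝ᵥ gVec W x)) := by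
    rw [covDI, gOuter, det_smul_vecMulVec_add_smul_one _ _ _ hσz2, Fintype.card_fin]
    field_simp
  have htop : ((σz ^ 2 : ℝ) : ℂ) +
      ((S ^ 2 * σβ ^ 2 : ℝ) : ℂ) * (star (gVec W x) ⬝ᵥ gVec W x) ≠ 0 :=
    right_ne_zero_of_mul (hdet ▸ (posDef_covDI W x S σβ hσz).det_pos.ne')
  have hrank := sq_mul_trace_inv_mul_eq hσz2 hgain htop
    (gMat_eq_vecMulVec_add W x p) (gMat_eq_vecMulVec_add W x j)
  rw [fisherDI_eq_gaussianFisher W x S σβ hσz, ofReal_gaussianFisher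
    (posDef_covDI W x S σβ hσz).isHermitian (isHermitian_covDIDeriv W x · S σβ), hdet, ofReal_gSq,
    ofReal_gTilde, ofReal_gTilde]
  simp only [covDIDeriv, mul_smul_comm, smul_mul_assoc, smul_smul, Matrix.trace_smul, smul_eq_mul,
    ← pow_two, covDI, gOuter, hrank]
  push_cast at hσz2 hgain htop ⊢
  field_simp

end Covariance

section BlockDiagonal

variable {m n : Type*} [Fintype m] [DecidableEq m] [Fintype n] [DecidableEq n]

theorem inv_blockDiagonal {𝕜 : Type*} [Field 𝕜] {C : m → Matrix n n 𝕜}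
    (hC : ∀ l, IsUnit (C l)) :
    (Matrix.blockDiagonal C)⁻¹ = Matrix.blockDiagonal fun l => (C l)⁻¹ := by
  refine Matrix.inv_eq_right_inv ?_
  rw [← Matrix.blockDiagonal_mul, ← Matrix.blockDiagonal_one]
  congr 1
  ext1 l
  exact Matrix.mul_nonsing_inv _ ((Matrix.isUnit_iff_isUnit_det _).mp (hC l))

omit [Fintype m] [Fintype n] [DecidableEq n] in
theorem posDef_blockDiagonal [Finite m] [Finite n] {𝕜 : Type*} [RCLike 𝕜] {C : m → Matrix n n 𝕜}
    (hC : ∀ l, (C l).PosDef) : (Matrix.blockDiagonal C).PosDef := by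
  have := Fintype.ofFinite m
  have := Fintype.ofFinite n
  have hquad (x : n × m → 𝕜) : star x ⬝ᵥ (Matrix.blockDiagonal C *ᵥ x) =
      ∑ l, star (fun i => x (i, l)) ⬝ᵥ (C l *ᵥ fun i => x (i, l)) := by
    simp [dotProduct, Matrix.mulVec, Matrix.blockDiagonal_apply, Fintype.sum_prod_type_right]
  refine Matrix.posDef_iff_dotProduct_mulVec.mpr
    ⟨Matrix.isHermitian_blockDiagonal_iff.mpr fun l => (hC l).isHermitian, fun x hx => ?_⟩
  obtain ⟨⟨i, l⟩, hil⟩ := Function.ne_iff.mp hx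
  rw [hquad]
  exact Finset.sum_pos' (fun l _ => (hC l).posSemidef.dotProduct_mulVec_nonneg _)
    ⟨l, Finset.mem_univ l, (hC l).dotProduct_mulVec_pos (Function.ne_iff.mpr ⟨i, hil⟩)⟩

theorem gaussianFisher_blockDiagonal {ι : Type*} {C : m → Matrix n n ℂ}
    (hC : ∀ l, IsUnit (C l)) (H : ι → m → Matrix n n ℂ) :
    gaussianFisher (Matrix.blockDiagonal C) (fun p => Matrix.blockDiagonal (H p)) =
      ∑ l, gaussianFisher (C l) (H · l) := by
  ext p q
  rw [Matrix.sum_apply]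
  simp only [gaussianFisher, Matrix.of_apply, inv_blockDiagonal hC, ← Matrix.blockDiagonal_mul,
    Matrix.trace_blockDiagonal, Complex.re_sum]

omit [Fintype m] [Fintype n] [DecidableEq n] in
theorem hasDerivAt_blockDiagonal [Finite m] [Finite n] {A : m → ℝ → Matrix n n ℂ}
    {H : m → Matrix n n ℂ} {t : ℝ} (hA : ∀ l, HasDerivAt (A l) (H l) t) :
    HasDerivAt (fun s => Matrix.blockDiagonal fun l => A l s) (Matrix.blockDiagonal H) t := by
  refine hasDerivAt_matrix_iff.mpr fun i j => ?_
  by_cases hij : i.2 = j.2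
  · simpa only [Matrix.blockDiagonal_apply, if_pos hij]
      using hasDerivAt_matrix_iff.mp (hA i.2) i.1 j.1
  · simpa only [Matrix.blockDiagonal_apply, if_neg hij] using hasDerivAt_const t (0 : ℂ)

end BlockDiagonal

section Observations

variable {M N k : ℕ} {S σβ σz : ℝ} (W : Fin k → Matrix (Fin M × Fin N) (Fin 3) ℂ)
  (x : EuclideanSpace ℝ (Fin 2))

/-- The covariance matrix of the observations of all cycles, stacked into one vector with the
cycle as second index because `Matrix.blockDiagonal` puts the block label there. -/
noncomputable def jointCov (S σβ σz : ℝ) : Matrix (Fin 3 × Fin k) (Fin 3 × Fin k) ℂ :=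
  Matrix.blockDiagonal fun l => covDI S σβ σz (W l) x

/-- The partial derivative of the joint covariance matrix `jointCov` with respect to `x_p`. -/
noncomputable def jointCovDeriv (S σβ : ℝ) (p : Fin 2) :
    Matrix (Fin 3 × Fin k) (Fin 3 × Fin k) ℂ :=
  Matrix.blockDiagonal fun l => covDIDeriv (W l) x p S σβ

/-- The matrix that maps the gains and the noise entries of all cycles to the stacked
observations; noise entries are indexed by (cycle, entry), observations by (entry, cycle). -/
noncomputable def observationMatrix (S : ℝ) :
    Matrix (Fin 3 × Fin k) (Fin k ⊕ Fin k × Fin 3) ℂ :=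
  Matrix.fromCols (Matrix.of fun q l => if q.2 = l then (S : ℂ) * gVec (W l) x q.1 else 0)
    (Matrix.of fun q r => if q.swap = r then 1 else 0)

theorem posDef_jointCov (S σβ : ℝ) (hσz : σz ≠ 0) : (jointCov W x S σβ σz).PosDef :=
  posDef_blockDiagonal fun l => posDef_covDI (W l) x S σβ hσz

theorem hasDerivAt_jointCov (S σβ σz : ℝ) (p : Fin 2) :
    HasDerivAt (fun t : ℝ => jointCov W (x + t • EuclideanSpace.single p (1 : ℝ)) S σβ σz)
      (jointCovDeriv W x S σβ p) 0 :=
  hasDerivAt_blockDiagonal fun l => hasDerivAt_covDI (W l) x p S σβ σz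

theorem continuous_jointCovDeriv (S σβ : ℝ) (p : Fin 2) :
    Continuous (jointCovDeriv W · S σβ p) :=
  Continuous.matrix_blockDiagonal (continuous_pi fun l => continuous_covDIDeriv (W l) p S σβ)

theorem gaussianFisher_jointCov (S σβ : ℝ) (hσz : σz ≠ 0) :
    gaussianFisher (jointCov W x S σβ σz) (jointCovDeriv W x S σβ) =
      ∑ l, fisherDI S σβ σz (W l) x := by
  simp_rw [fisherDI_eq_gaussianFisher (W _) x S σβ hσz]
  exact gaussianFisher_blockDiagonal (fun l => (posDef_covDI (W l) x S σβ hσz).isUnit)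
    fun p l => covDIDeriv (W l) x p S σβ

theorem observationMatrix_mulVec (b : Fin k → ℂ) (w : Fin k × Fin 3 → ℂ) (i : Fin 3) (l : Fin k) :
    (observationMatrix W x S *ᵥ Sum.elim b w) (i, l) =
      observation S (W l) x (b l) (fun i => w (l, i)) i := by
  simp [observationMatrix, Matrix.mulVec, dotProduct, observation, mul_right_comm]

theorem observationMatrix_mul_diagonal_mul_conjTranspose (S σβ σz : ℝ) :
    observationMatrix W x S *
        Matrix.diagonal (fun r : Fin k ⊕ Fin k × Fin 3 =>
          ((Sum.elim (fun _ => σβ) (fun _ => σz) r : ℝ) : ℂ) ^ 2) *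
        (observationMatrix W x S)ᴴ = jointCov W x S σβ σz := by
  ext ⟨i, l⟩ ⟨j, m⟩
  rw [Matrix.mul_apply, Fintype.sum_sum_type]
  simp_rw [Matrix.mul_diagonal]
  by_cases hlm : l = m
  · subst hlm
    simp [observationMatrix, jointCov, covDI, gOuter, Matrix.vecMulVec_apply, Matrix.one_apply,
      apply_ite (starRingEnd ℂ)]
    ring
  · simp [observationMatrix, jointCov, hlm, apply_ite (starRingEnd ℂ), Matrix.blockDiagonal_apply]

theorem hasLaw_observation {Ω : Type*} [MeasurableSpace Ω] {μ : Measure Ω} {β : Fin k → Ω → ℂ}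
    {z : Fin k → Fin 3 → Ω → ℂ} (S : ℝ) (hσz : σz ≠ 0)
    (hβ : ∀ l, HasLaw (β l) (complexGaussian σβ) μ)
    (hz : ∀ l i, HasLaw (z l i) (complexGaussian σz) μ)
    (hindep : iIndepFun (Sum.elim β fun q : Fin k × Fin 3 => z q.1 q.2) μ) :
    HasLaw (fun ω (q : Fin 3 × Fin k) =>
        observation S (W q.2) x (β q.2 ω) (fun i => z q.2 i ω) q.1)
      (circularGaussian (jointCov W x S σβ σz)) μ := by
  let τ : Fin k ⊕ Fin k × Fin 3 → ℝ := Sum.elim (fun _ => σβ) fun _ => σz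
  have hsource : HasLaw (fun ω => Sum.elim (β · ω) fun r => z r.1 r.2 ω)
      (Measure.pi fun r => complexGaussian (τ r)) μ :=
    (hindep.hasLaw_pi (Sum.rec hβ fun r => hz r.1 r.2)).congr
      (.of_forall fun ω => funext (Sum.rec (fun _ => rfl) fun _ => rfl))
  have hmix : HasLaw (observationMatrix W x S *ᵥ ·) (circularGaussian (jointCov W x S σβ σz))
      (Measure.pi fun r => complexGaussian (τ r)) :=
    ⟨by fun_prop, pi_complexGaussian_map_mulVec τ _ (posDef_jointCov W x S σβ hσz)
      (observationMatrix_mul_diagonal_mul_conjTranspose W x S σβ σz)⟩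
  refine (hmix.comp hsource).congr (.of_forall fun ω => funext fun q => ?_)
  obtain ⟨i, l⟩ := q
  exact (observationMatrix_mulVec W x (β · ω) (fun r => z r.1 r.2 ω) i l).symm

theorem trace_inv_sum_fisherDI_le (S σβ : ℝ) (hσz : σz ≠ 0)
    {F : (Fin 3 × Fin k → ℂ) → EuclideanSpace ℝ (Fin 2)}
    (hunbiased : ∀ᶠ x' in 𝓝 x, Integrable F (circularGaussian (jointCov W x' S σβ σz)) ∧
      ∫ v, F v ∂circularGaussian (jointCov W x' S σβ σz) = x')
    (hfisher : IsUnit (∑ l, fisherDI S σβ σz (W l) x)) :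
    ENNReal.ofReal (∑ l, fisherDI S σβ σz (W l) x)⁻¹.trace ≤
      ∫⁻ v, ENNReal.ofReal (‖F v - x‖ ^ 2) ∂circularGaussian (jointCov W x S σβ σz) := by
  rw [← gaussianFisher_jointCov W x S σβ hσz] at hfisher ⊢
  exact trace_inv_gaussianFisher_le (C := (jointCov W · S σβ σz))
    (H := fun p x' => jointCovDeriv W x' S σβ p)
    (.of_forall fun x' => posDef_jointCov W x' S σβ hσz)
    (fun p => .of_forall fun x' => hasDerivAt_jointCov W x' S σβ σz p)
    (fun p => (continuous_jointCovDeriv W S σβ p).continuousAt) hunbiased hfisher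

end Observations

end BeamTracking

open BeamTracking in
theorem lemma4 {Ω : Type*} [MeasurableSpace Ω] (μ : Measure Ω) [IsProbabilityMeasure μ]
    (M N k L : ℕ)
    -- pilot sequence and standard deviations of the equivalent channel gain and of the noise
    (s : EuclideanSpace ℂ (Fin L)) (hs : s ≠ 0)
    (σβ σz : ℝ) (hσβ : 0 < σβ) (hσz : 0 < σz)
    -- the given exploring beamforming matrices
    (W : Fin k → Matrix (Fin M × Fin N) (Fin 3) ℂ)
    -- equivalent channel gains (Rayleigh fading) and observation noise
    (β : Fin k → Ω → ℂ) (z : Fin k → Fin 3 → Ω → ℂ)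
    (hβ : ∀ l, HasLaw (β l) (complexGaussian σβ) μ)
    (hz : ∀ l i, HasLaw (z l i) (complexGaussian σz) μ)
    (hindep : iIndepFun (Sum.elim β fun q : Fin k × Fin 3 => z q.1 q.2) μ)
    -- the observations of the `k` cycles as a function of the direction
    (y : EuclideanSpace ℝ (Fin 2) → Ω → Fin k → Fin 3 → ℂ)
    (hy : ∀ x ω l, y x ω l = observation ‖s‖ (W l) x (β l ω) (fun i => z l i ω))
    (x : EuclideanSpace ℝ (Fin 2)) :
    -- the Cramér–Rao bound for every estimator that is unbiased for all directions near `x`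
    (∀ F : (Fin k → Fin 3 → ℂ) → EuclideanSpace ℝ (Fin 2), Measurable F →
      (∀ᶠ x' in 𝓝 x, Integrable (fun ω => F (y x' ω)) μ ∧ ∫ ω, F (y x' ω) ∂μ = x') →
      IsUnit (∑ l, fisherDI ‖s‖ σβ σz (W l) x) →
      ENNReal.ofReal (∑ l, fisherDI ‖s‖ σβ σz (W l) x)⁻¹.trace ≤
        ∫⁻ ω, ENNReal.ofReal (‖F (y x ω) - x‖ ^ 2) ∂μ) ∧
    -- the entries of the Fisher information matrices
    (∀ (l : Fin k) (p j : Fin 2),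
      Integrable (fun v : Fin 3 → ℂ => scoreDI ‖s‖ σβ σz (W l) x p v *
        scoreDI ‖s‖ σβ σz (W l) x j v * pDI ‖s‖ σβ σz (W l) x v) ∧
      ((fisherDI ‖s‖ σβ σz (W l) x p j : ℝ) : ℂ) =
        (σz ^ 6 * ‖s‖ ^ 6 * σβ ^ 6 : ℝ) / (covDI ‖s‖ σβ σz (W l) x).det ^ 2 *
          (-2 * (gSq (W l) x : ℂ) * (gTilde (W l) x p : ℂ) * (gTilde (W l) x j : ℂ)
            + ((σz ^ 2 / (‖s‖ ^ 2 * σβ ^ 2) : ℝ) : ℂ) *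
                (gMat (W l) x p * gMat (W l) x j).trace
            + star (gVec (W l) x) ⬝ᵥ
                ((gMat (W l) x p * gMat (W l) x j + gMat (W l) x j * gMat (W l) x p) *ᵥ
                  gVec (W l) x))) := by
  refine ⟨fun F hF hunbiased hfisher => ?_, fun l p j => ⟨?_, ?_⟩⟩
  · let F' (v : Fin 3 × Fin k → ℂ) : EuclideanSpace ℝ (Fin 2) := F fun l i => v (i, l)
    have hF' : Measurable F' := hF.comp (by fun_prop)
    have hlaw (x') : HasLaw (fun ω (q : Fin 3 × Fin k) => y x' ω q.2 q.1)
        (circularGaussian (jointCov W x' ‖s‖ σβ σz)) μ := by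
      simpa only [hy] using hasLaw_observation W x' ‖s‖ hσz.ne' hβ hz hindep
    have hunbiased' : ∀ᶠ x' in 𝓝 x,
        Integrable F' (circularGaussian (jointCov W x' ‖s‖ σβ σz)) ∧
          ∫ v, F' v ∂circularGaussian (jointCov W x' ‖s‖ σβ σz) = x' := by
      filter_upwards [hunbiased] with x' h
      rwa [← (hlaw x').map_eq, integrable_map_measure hF'.aestronglyMeasurable
        (hlaw x').aemeasurable, integral_map (hlaw x').aemeasurable hF'.aestronglyMeasurable]
    refine (trace_inv_sum_fisherDI_le W x ‖s‖ σβ hσz.ne' hunbiased' hfisher).trans_eq ?_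
    exact ((hlaw x).lintegral_comp (by fun_prop)).symm
  · exact integrable_scoreDI_mul_scoreDI_mul_pDI (W l) x p j ‖s‖ σβ hσz.ne'
  · exact ofReal_fisherDI (W l) x p j (norm_ne_zero_iff.mpr hs) hσβ.ne' hσz.ne'
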